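/- **Setting.** For every sample size $n$ let $Y_i=X_i\beta+e_i$, $X_i=\Pi_i+V_i$ ($i\le n$), with $\mathbb E e_i=\mathbb E V_i=0$, $\Pi_i$ non-random, a non-random $n\times K$ instrument matrix $Z$ of full column rank, $K=K_n\to\infty$, and $P=Z(Z^\top Z)^{-1}Z^\top$; $\beta$ does not depend on $n$. Put $Q_{a,b}=K^{-1/2}\sum_i\sum_{j\ne i}a_iP_{ij}b_j$, $\mathcal C=Q_{\Pi,\Pi}$, $e_i(\beta_0)=Y_i-X_i\beta_0$, $\Delta=\beta-\beta_0$, where $\beta_0\in\mathcal B$ and $\mathcal B\subset\mathbb R$ is compact. Fix $\alpha\in(0,1)$, $\overline a<1$, $p_1\in(0,1)$, $p_2>1$ (for instance $p_1=0.01$, $p_2=1.1$). *Variance parameter.* Given a symmetric $3\times3$ matrix with entries $\Phi_1,\Phi_{12},\Phi_{13};\Psi,\tau;\Upsilon$ (rows of the upper triangle), let $\gamma(\beta_0)=(\Phi_1(\beta_0),\Phi_{12}(\beta_0),\Phi_{13}(\beta_0),\Psi(\beta_0),\tau(\beta_0),\Upsilon,\rho(\beta_0))$, where $\Phi_1(\beta_0)=\Delta^4\Upsilon+4\Delta^3\tau+\Delta^2(4\Psi+2\Phi_{13})+4\Delta\Phi_{12}+\Phi_1$,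 $\Phi_{12}(\beta_0)=\Delta^3\Upsilon+3\Delta^2\tau+\Delta(2\Psi+\Phi_{13})+\Phi_{12}$, $\Phi_{13}(\beta_0)=\Delta^2\Upsilon+2\Delta\tau+\Phi_{13}$, $\Psi(\beta_0)=\Delta^2\Upsilon+2\Delta\tau+\Psi$, $\tau(\beta_0)=\Delta\Upsilon+\tau$, $\rho(\beta_0)=\Phi_{12}(\beta_0)/\sqrt{\Phi_1(\beta_0)\Psi(\beta_0)}$. Let $\Gamma\subseteq\mathbb R^7$ be a parameter space containing $\gamma(\beta_0)$ and all values of an estimator $\widehat\gamma(\beta_0)$, whose entries carry hats. For $r=(\Phi_1,\Phi_{12},\Phi_{13},\Psi,\tau,\Upsilon,\rho)\in\Gamma$ put $k(r)=\begin{pmatrix}\Phi_1&\Phi_{12}\\ \Phi_{12}&\Psi\end{pmatrix}^{-1}\begin{pmatrix}\Phi_{13}\\ \tau\end{pmatrix}$, $\sigma_D^2(r)=\Upsilon-(\Phi_{13},\tau)k(r)$ and $B_r(\delta)=1-(\delta^2,\delta)k(r)$. *Statistics.* $AR=Q_{e(\beta_0),e(\beta_0)}/\widehat\Phi_1^{1/2}$,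 $LM=Q_{X,e(\beta_0)}/\widehat\Psi^{1/2}$, $LM^*=(1-\widehat\rho^2)^{-1/2}(LM-\widehat\rho\,AR)$, $\widehat D=Q_{X,X}-(Q_{e(\beta_0),e(\beta_0)},Q_{X,e(\beta_0)})\,k(\widehat\gamma(\beta_0))$. *Weights.* For $a=(a_1,a_2)$ let $T_{a,\rho}(x,y)=a_1x^2+a_2(\rho x+(1-\rho^2)^{1/2}y)^2+(1-a_1-a_2)y^2$ and let $\mathbb C_\alpha(a;\rho)$ be the $(1-\alpha)$-quantile of $T_{a,\rho}(\mathcal Z_1,\mathcal Z_2)$, with $\mathcal Z_1,\mathcal Z_2$ independent standard normals. Let $\mathbb A_0=\{a\in[0,1]^2:a_1+a_2\le\overline a\}$, $\mathcal D(\beta_0)=\{\delta:\delta+\beta_0\in\mathcal B\}$, $C_1(\delta)=\Phi_1^{-1/2}\delta^2/B_r(\delta)$, $C_2(\delta)=(1-\rho^2)^{-1/2}(\Psi^{-1/2}\delta-\rho\Phi_1^{-1/2}\delta^2)/B_r(\delta)$ (both read as $0$ if $B_r(\delta)=0$), and $\pi_a(\delta,\mu,r)=\mathbb P\{T_{a,\rho}(\mathcal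 Z_1+C_1(\delta)\mu,\mathcal Z_2+C_2(\delta)\mu)\ge\mathbb C_\alpha(a;\rho)\}$. Let $\mathbb A(\mu,r)$ be the set of $a\in\mathbb A_0$ with $a_1\ge\underline a(\mu,r)$, where $$\underline a(\mu,r)=\min\Big(p_1,\;p_2\,\sup_{a\in\mathbb A_0}\mathbb C_\alpha(a;\rho)\,\Phi_1\,\sup_{\delta\in\mathcal D(\beta_0)}B_r(\delta)^2\,\Delta_*^{-4}\mu^{-2}\Big),\qquad \Delta_*^{-1}=\Phi_1^{-1/2}\Psi^{1/2}\rho,$$ and $\underline a(0,r)=p_1$. For $s\in\{pp,krs\}$ let $f_s(d,r)=\sigma_D(r)\sqrt{R_s(d^2/\sigma_D^2(r))}$, $R_{pp}(x)=\max(x-1,0)$, $R_{krs}(x)=x-1+e^{-x/2}\big(\sum_{j\ge0}(-x/2)^j/(j!(1+2j))\big)^{-1}$. Let $\mathcal A_s:\mathbb R\times\Gamma\to\mathbb R^2$ be a measurable function such that, with $\mu=f_s(d,r)$, $\mathcal A_s(d,r)$ minimizes $\sup_{\delta\in\mathcal D(\beta_0)}\big(\sup_{a'\in\mathbb A(\mu,r)}\pi_{a'}(\delta,\mu,r)-\pi_a(\delta,\mu,r)\big)$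 over $a\in\mathbb A(\mu,r)$. The feasible CLC test is $$\widehat\phi=1\{\mathcal A_{1,s}AR^2+\mathcal A_{2,s}LM^2+(1-\mathcal A_{1,s}-\mathcal A_{2,s})LM^{*2}\ge\mathbb C_\alpha(\mathcal A_s;\widehat\rho)\},\qquad \mathcal A_s=\mathcal A_s(\widehat D,\widehat\gamma(\beta_0)).$$ *Rotation.* With $a=\mathcal A_s(d,r)$, let $\begin{pmatrix}a_1+a_2\rho^2&a_2\rho(1-\rho^2)^{1/2}\\ a_2\rho(1-\rho^2)^{1/2}&1-a_1-a_2\rho^2\end{pmatrix}=\mathcal U_s(d,r)\,\mathrm{diag}(\nu_1(d,r),\nu_2(d,r))\,\mathcal U_s(d,r)^\top$, with $\mathcal U_s$ orthogonal and measurable and $\nu_1\ge\nu_2$, and let $(\widetilde{AR}_s,\widetilde{LM}{}^*_s)^\top=\mathcal U_s(\widehat D,\widehat\gamma(\beta_0))^\top(AR,LM^*)^\top$. *Competitors.* $\Phi_\alpha$ is the set of measurable $\tilde\phi:\mathbb R^3\times\Gamma\to[0,1]$ with $\mathbb E\tilde\phi(\mathcal Z_1^2,\mathcal Z_2^2,d,r)\le\alpha$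 for all $(d,r)\in\mathbb R\times\Gamma$ and such that, for every $r\in\Gamma$, $\tilde\phi$ is continuous at $(z_1,z_2,d,r)$ for Lebesgue-almost every $(z_1,z_2,d)\in\mathbb R^3$. **Assumptions.** Fix $s$ and one value $\gamma(\beta_0)\in\Gamma$. Let $\mathcal M$ be a class of sequences (in $n$) of models as above, with $\beta\in\mathbb R$ allowed to differ between sequences, all having this $\gamma(\beta_0)$, such that for each sequence: weak identification holds, $\mathcal C\to\widetilde{\mathcal C}\in\mathbb R$; (1) $(Q_{e,e},Q_{X,e},Q_{X,X}-\mathcal C)$ converges in distribution to a centred normal vector with a positive definite covariance matrix with entries $\Phi_1,\Phi_{12},\Phi_{13};\Psi,\tau;\Upsilon$; (2) $\|\widehat\gamma(\beta_0)-\gamma(\beta_0)\|_2\to0$ in probability. Moreover, for Lebesgue-almost every $d$, (3) $\mathcal A_s$ and (4) $\mathcal U_s$ are continuous, as functions on $\mathbb R\times\Gamma$, at $(d,\gamma(\beta_0))$. For a sequence in $\mathcal M$ and $d\in\mathbb R$ let $(\theta_1,\theta_2)=(m_1,m_2)\,\mathcal U_s(d,\gamma(\beta_0))$, where $m_1=\Phi_1(\beta_0)^{-1/2}\Delta^2\widetilde{\mathcal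 C}$ and $m_2=(1-\rho(\beta_0)^2)^{-1/2}\big(\Psi(\beta_0)^{-1/2}\Delta\widetilde{\mathcal C}-\rho(\beta_0)\Phi_1(\beta_0)^{-1/2}\Delta^2\widetilde{\mathcal C}\big)$. **Claim.** Let $\tilde\phi\in\Phi_\alpha$, and let $R$ be the set of $d$ such that $\mathcal A_s(\cdot,\gamma(\beta_0))$ and $\mathcal U_s(\cdot,\gamma(\beta_0))$ are continuous at $d$ and, for almost every $(z_1,z_2)$, $\tilde\phi(\cdot,\cdot,\cdot,\gamma(\beta_0))$ is continuous at $(z_1,z_2,d)$. Then $\mathbb R\setminus R$ is Lebesgue null, and for every $d\in R$ and every sequence in $\mathcal M$ the limits $$\tilde p=\lim_{\varepsilon\downarrow0}\lim_{n\to\infty}\frac{\mathbb E\,\tilde\phi(\widetilde{AR}_s^2,\widetilde{LM}{}_s^{*2},\widehat D,\widehat\gamma(\beta_0))\,1\{|\widehat D-d|\le\varepsilon\}}{\mathbb E\,1\{|\widehat D-d|\le\varepsilon\}},\qquad \hat p=\lim_{\varepsilon\downarrow0}\lim_{n\to\infty}\frac{\mathbb E\,\widehat\phi\,1\{|\widehat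 D-d|\le\varepsilon\}}{\mathbb E\,1\{|\widehat D-d|\le\varepsilon\}}$$ exist, and: (i) Suppose that the points $(\theta_1,\theta_2)$ of the sequences in $\mathcal M$ are dense in $\mathbb R^2$ (as they are when every pair $(\Delta,\widetilde{\mathcal C})\in\mathbb R^2$ occurs). If $\tilde p\ge\hat p$ for all sequences in $\mathcal M$, then $\tilde p=\hat p$ for all sequences in $\mathcal M$. (ii) There is $\overline b>0$ such that $\tilde p\le\hat p$ for every sequence in $\mathcal M$ for which $(\theta_1^2,\theta_2^2)=b\,(\nu_1(d,\gamma(\beta_0)),\nu_2(d,\gamma(\beta_0)))$ with some $0<b<\overline b$. -/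

import Mathlib

open MeasureTheory ProbabilityTheory Filter Topology Matrix

universe u

noncomputable section

namespace JackknifeCLC

/-! ### Variance parameters -/

/-- The vector `γ = (Φ₁, Φ₁₂, Φ₁₃, Ψ, τ, Υ, ρ)`, with the Euclidean norm. -/
abbrev VarPar : Type := EuclideanSpace ℝ (Fin 7)

namespace VarPar

def Phi1 (r : VarPar) : ℝ := r 0
def Phi12 (r : VarPar) : ℝ := r 1
def Phi13 (r : VarPar) : ℝ := r 2
def Psi (r : VarPar) : ℝ := r 3
def tau (r : VarPar) : ℝ := r 4
def Ups (r : VarPar) : ℝ := r 5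
def rho (r : VarPar) : ℝ := r 6

/-- Coefficients of the projection of `Q_XX` on `(Q_{e(β₀)e(β₀)}, Q_{Xe(β₀)})`. -/
def projCoef (r : VarPar) : Fin 2 → ℝ :=
  (!![r.Phi1, r.Phi12; r.Phi12, r.Psi])⁻¹ *ᵥ ![r.Phi13, r.tau]

/-- Residual standard deviation `σ_D` of that projection. -/
def sigmaD (r : VarPar) : ℝ :=
  √(r.Ups - ![r.Phi13, r.tau] ⬝ᵥ r.projCoef)

/-- `1 - (δ², δ) S⁻¹ (Φ₁₃, τ)ᵀ`. -/
def bracket (r : VarPar) (δ : ℝ) : ℝ := 1 - ![δ ^ 2, δ] ⬝ᵥ r.projCoef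

def C1 (r : VarPar) (δ : ℝ) : ℝ := (√r.Phi1)⁻¹ * δ ^ 2 * (r.bracket δ)⁻¹

def C2 (r : VarPar) (δ : ℝ) : ℝ :=
  (√(1 - r.rho ^ 2))⁻¹ * ((√r.Psi)⁻¹ * δ - r.rho * (√r.Phi1)⁻¹ * δ ^ 2) * (r.bracket δ)⁻¹

/-- The reciprocal `1/Δ_*` of `Δ_* = Φ₁^{1/2} Ψ^{-1/2} ρ^{-1}`; it is `0` when `ρ = 0`
(where `Δ_*` is infinite). -/
def invDeltaStar (r : VarPar) : ℝ := (√r.Phi1)⁻¹ * √r.Psi * r.rho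

/-- First limiting mean `m₁(Δ)`, for limiting concentration parameter `C`. -/
def m1 (r : VarPar) (Δ C : ℝ) : ℝ := (√r.Phi1)⁻¹ * Δ ^ 2 * C

/-- Second limiting mean `m₂(Δ)`. -/
def m2 (r : VarPar) (Δ C : ℝ) : ℝ :=
  (√(1 - r.rho ^ 2))⁻¹ * (√r.Psi)⁻¹ * Δ * C
    - r.rho * (√(1 - r.rho ^ 2))⁻¹ * (√r.Phi1)⁻¹ * Δ ^ 2 * C

end VarPar

/-- `γ(β₀)` as a function of `Δ = β - β₀` and of the limiting covariance matrix `S` of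
`(Q_ee, Q_Xe, Q_XX - 𝒞)`, `S = [[Φ₁, Φ₁₂, Φ₁₃], [Φ₁₂, Ψ, τ], [Φ₁₃, τ, Υ]]`. -/
def gammaAt (S : Matrix (Fin 3) (Fin 3) ℝ) (Δ : ℝ) : VarPar :=
  let Phi1 := S 0 0
  let Phi12 := S 0 1
  let Phi13 := S 0 2
  let Psi := S 1 1
  let tau := S 1 2
  let Ups := S 2 2
  let Phi1' := Δ ^ 4 * Ups + 4 * Δ ^ 3 * tau + Δ ^ 2 * (4 * Psi + 2 * Phi13)
    + 4 * Δ * Phi12 + Phi1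
  let Phi12' := Δ ^ 3 * Ups + 3 * Δ ^ 2 * tau + Δ * (2 * Psi + Phi13) + Phi12
  let Phi13' := Δ ^ 2 * Ups + 2 * Δ * tau + Phi13
  let Psi' := Δ ^ 2 * Ups + 2 * Δ * tau + Psi
  let tau' := Δ * Ups + tau
  !₂[Phi1', Phi12', Phi13', Psi', tau', Ups, Phi12' / √(Phi1' * Psi')]

/-! ### Linear combination tests in the limit experiment -/

/-- Law of `(𝒵₁(μ₁), 𝒵₂(μ₂))`: independent normals with unit variances, means `μ₁, μ₂`. -/
def normal2 (μ₁ μ₂ : ℝ) : Measure (ℝ × ℝ) := (gaussianReal μ₁ 1).prod (gaussianReal μ₂ 1)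

/-- `a₁ x² + a₂ (ρ x + (1-ρ²)^{1/2} y)² + (1-a₁-a₂) y²`. -/
def combStat (a : ℝ × ℝ) (ρ x y : ℝ) : ℝ :=
  a.1 * x ^ 2 + a.2 * (ρ * x + √(1 - ρ ^ 2) * y) ^ 2 + (1 - a.1 - a.2) * y ^ 2

/-- `ℂ_α(a₁, a₂; ρ)`: the `(1-α)`-quantile of the combination of two independent standard
normals. -/
def critVal (α : ℝ) (a : ℝ × ℝ) (ρ : ℝ) : ℝ :=
  sInf {c : ℝ | 1 - α ≤ (normal2 0 0).real {z | combStat a ρ z.1 z.2 ≤ c}}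

/-- `𝔸₀`. -/
def weights0 (abar : ℝ) : Set (ℝ × ℝ) :=
  {a | 0 ≤ a.1 ∧ a.1 ≤ 1 ∧ 0 ≤ a.2 ∧ a.2 ≤ 1 ∧ a.1 + a.2 ≤ abar}

/-- `ℂ_{α,max}(ρ)`. -/
def critMax (α abar ρ : ℝ) : ℝ := sSup ((fun a => critVal α a ρ) '' weights0 abar)

/-- `𝔼 φ_{a₁,a₂,∞}(δ, μ_D, γ)` at `μ_D = μ`, `γ = r`. -/
def limitPower (α : ℝ) (a : ℝ × ℝ) (δ μ : ℝ) (r : VarPar) : ℝ :=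
  (normal2 (r.C1 δ * μ) (r.C2 δ * μ)).real
    {z | critVal α a r.rho ≤ combStat a r.rho z.1 z.2}

/-! ### The minimax weights -/

/-- The fixed ingredients of the procedure: level `α`, bound `ā` on the total weight, tuning
constants `p₁, p₂`, parameter space `ℬ` and hypothesized value `β₀`. -/
structure Design where
  α : ℝ
  abar : ℝ
  p1 : ℝ
  p2 : ℝ
  B : Set ℝ
  β0 : ℝ

structure Design.Valid (𝒟 : Design) : Prop where
  α_pos : 0 < 𝒟.α
  α_lt_one : 𝒟.α < 1
  abar_lt_one : 𝒟.abar < 1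
  p1_pos : 0 < 𝒟.p1
  p1_lt_one : 𝒟.p1 < 1
  one_lt_p2 : 1 < 𝒟.p2
  compact_B : IsCompact 𝒟.B
  β0_mem : 𝒟.β0 ∈ 𝒟.B

namespace Design

variable (𝒟 : Design)

/-- `𝒟(β₀) = {δ : δ + β₀ ∈ ℬ}`. -/
def deltas : Set ℝ := {δ | δ + 𝒟.β0 ∈ 𝒟.B}

def cB (r : VarPar) : ℝ := sSup ((fun δ => r.bracket δ ^ 2) '' 𝒟.deltas)

/-- The lower bound `a̲(μ, γ)`, with the convention `C/0 = +∞`, so that it is `p₁` at `μ = 0`. -/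
def aLow (μ : ℝ) (r : VarPar) : ℝ :=
  if μ = 0 then 𝒟.p1
  else min 𝒟.p1
    (𝒟.p2 * critMax 𝒟.α 𝒟.abar r.rho * r.Phi1 * 𝒟.cB r * r.invDeltaStar ^ 4 / μ ^ 2)

/-- The domain `𝔸(μ, γ)` of the weights. -/
def weights (μ : ℝ) (r : VarPar) : Set (ℝ × ℝ) :=
  {a | a ∈ weights0 𝒟.abar ∧ 𝒟.aLow μ r ≤ a.1}

/-- Highest attainable power against `δ`. -/
def bestPower (δ μ : ℝ) (r : VarPar) : ℝ :=
  sSup ((fun a => limitPower 𝒟.α a δ μ r) '' 𝒟.weights μ r)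

/-- Maximum regret of the weights `a`. -/
def maxRegret (a : ℝ × ℝ) (μ : ℝ) (r : VarPar) : ℝ :=
  sSup ((fun δ => 𝒟.bestPower δ μ r - limitPower 𝒟.α a δ μ r) '' 𝒟.deltas)

/-- `a` minimizes the maximum regret over `𝔸(μ, γ)`. -/
def IsMinimax (a : ℝ × ℝ) (μ : ℝ) (r : VarPar) : Prop :=
  a ∈ 𝒟.weights μ r ∧ ∀ a' ∈ 𝒟.weights μ r, 𝒟.maxRegret a μ r ≤ 𝒟.maxRegret a' μ r

end Design

/-- The two proxies for `μ_D`. -/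
inductive Proxy where
  | pp
  | krs

/-- `r_pp` and `r_krs` as functions of `x = D²/σ_D²`. -/
def Proxy.rEst : Proxy → ℝ → ℝ
  | .pp, x => max (x - 1) 0
  | .krs, x => x - 1 + Real.exp (-x / 2) *
      (∑' j : ℕ, (-x / 2) ^ j / ((j.factorial : ℝ) * (1 + 2 * (j : ℝ))))⁻¹

/-- The proxy `f_s(d, γ)`. -/
def Proxy.f (s : Proxy) (d : ℝ) (r : VarPar) : ℝ :=
  r.sigmaD * √(s.rEst (d ^ 2 / r.sigmaD ^ 2))

/-! ### Eigenvalue decomposition -/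

def weightMatrix (a : ℝ × ℝ) (ρ : ℝ) : Matrix (Fin 2) (Fin 2) ℝ :=
  !![a.1 + a.2 * ρ ^ 2, a.2 * ρ * √(1 - ρ ^ 2);
     a.2 * ρ * √(1 - ρ ^ 2), 1 - a.1 - a.2 * ρ ^ 2]

/-- `M = 𝒰 diag(ν₁, ν₂) 𝒰ᵀ` with `𝒰` orthogonal and `ν₁ ≥ ν₂`. -/
def IsEigenDecomp (M U : Matrix (Fin 2) (Fin 2) ℝ) (ν : Fin 2 → ℝ) : Prop :=
  U ∈ Matrix.orthogonalGroup (Fin 2) ℝ ∧ ν 1 ≤ ν 0 ∧ M = U * Matrix.diagonal ν * Uᵀ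

/-! ### Sequences of linear IV models -/

/-- A sequence, in the sample size `n`, of linear IV models `Y = X β + e`, `X = Π + V` with a
fixed `n × K` instrument matrix `Z` and a true value `β` not depending on `n`, together with an
estimator of `γ(β₀)` with values in the parameter space `Γ`. The last two fields are the limit of
the concentration parameter and the limiting covariance matrix. -/
structure DGP (Γ : Set VarPar) where
  Ω : ℕ → Type u
  mΩ : ∀ n, MeasurableSpace (Ω n)
  law : ∀ n, Measure (Ω n)
  prob : ∀ n, IsProbabilityMeasure (law n)
  β : ℝ
  K : ℕ → ℕ
  Z : ∀ n, Matrix (Fin n) (Fin (K n)) ℝ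
  Pi : ∀ n, Fin n → ℝ
  e : ∀ n, Ω n → Fin n → ℝ
  V : ∀ n, Ω n → Fin n → ℝ
  gammaHat : ∀ n, Ω n → Γ
  Ctilde : ℝ
  S : Matrix (Fin 3) (Fin 3) ℝ

namespace DGP

attribute [instance] DGP.mΩ DGP.prob

variable {Γ : Set VarPar} (E : DGP.{u} Γ)

/-- `P = Z (ZᵀZ)⁻¹ Zᵀ`. -/
def P (n : ℕ) : Matrix (Fin n) (Fin n) ℝ := E.Z n * ((E.Z n)ᵀ * E.Z n)⁻¹ * (E.Z n)ᵀ

/-- `Q_{a,b} = K^{-1/2} ∑_i ∑_{j ≠ i} a_i P_ij b_j`. -/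
def Q (n : ℕ) (a b : Fin n → ℝ) : ℝ :=
  (∑ i, ∑ j ∈ Finset.univ.erase i, a i * E.P n i j * b j) / √(E.K n : ℝ)

def X (n : ℕ) (ω : E.Ω n) : Fin n → ℝ := fun i => E.Pi n i + E.V n ω i

def Y (n : ℕ) (ω : E.Ω n) : Fin n → ℝ := fun i => E.X n ω i * E.β + E.e n ω i

/-- `e_i(β₀) = Y_i - X_i β₀`. -/
def eAt (β0 : ℝ) (n : ℕ) (ω : E.Ω n) : Fin n → ℝ := fun i => E.Y n ω i - E.X n ω i * β0

/-- The concentration parameter `𝒞 = Q_{Π,Π}`. -/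
def conc (n : ℕ) : ℝ := E.Q n (E.Pi n) (E.Pi n)

/-- The standing assumptions on the model. -/
structure IsModel : Prop where
  measurable_e : ∀ n i, Measurable fun ω => E.e n ω i
  measurable_V : ∀ n i, Measurable fun ω => E.V n ω i
  integrable_e : ∀ n i, Integrable (fun ω => E.e n ω i) (E.law n)
  integrable_V : ∀ n i, Integrable (fun ω => E.V n ω i) (E.law n)
  mean_e : ∀ n i, ∫ ω, E.e n ω i ∂(E.law n) = 0
  mean_V : ∀ n i, ∫ ω, E.V n ω i ∂(E.law n) = 0
  invertible : ∀ n, IsUnit ((E.Z n)ᵀ * E.Z n).det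
  K_tendsto : Tendsto E.K atTop atTop

/-- Weak identification: `𝒞` converges to a finite limit. -/
def WeakIdentification : Prop := Tendsto E.conc atTop (𝓝 E.Ctilde)

/-- Joint asymptotic normality of `(Q_ee, Q_Xe, Q_XX - 𝒞)`, with nonsingular limit. -/
def AsympNormal : Prop :=
  E.S.PosDef ∧
  TendstoInDistribution
    (fun n ω => (!₂[E.Q n (E.e n ω) (E.e n ω), E.Q n (E.X n ω) (E.e n ω),
      E.Q n (E.X n ω) (E.X n ω) - E.conc n] : EuclideanSpace ℝ (Fin 3)))
    atTop (id : EuclideanSpace ℝ (Fin 3) → EuclideanSpace ℝ (Fin 3))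
    E.law (multivariateGaussian 0 E.S)

/-- The variance parameter at `β₀` is `r0`, and it is estimated consistently. -/
def ConsistentAt (β0 : ℝ) (r0 : Γ) : Prop :=
  (r0 : VarPar) = gammaAt E.S (E.β - β0) ∧
  (∀ n, Measurable (E.gammaHat n)) ∧
  ∀ η : ℝ, 0 < η →
    Tendsto (fun n => (E.law n).real {ω | η ≤ ‖(E.gammaHat n ω : VarPar) - r0‖}) atTop (𝓝 0)

/-! ### Statistics and feasible tests -/

def AR (β0 : ℝ) (n : ℕ) (ω : E.Ω n) : ℝ :=
  E.Q n (E.eAt β0 n ω) (E.eAt β0 n ω) / √(E.gammaHat n ω : VarPar).Phi1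

def LM (β0 : ℝ) (n : ℕ) (ω : E.Ω n) : ℝ :=
  E.Q n (E.X n ω) (E.eAt β0 n ω) / √(E.gammaHat n ω : VarPar).Psi

def LMstar (β0 : ℝ) (n : ℕ) (ω : E.Ω n) : ℝ :=
  (√(1 - (E.gammaHat n ω : VarPar).rho ^ 2))⁻¹ *
    (E.LM β0 n ω - (E.gammaHat n ω : VarPar).rho * E.AR β0 n ω)

def Dhat (β0 : ℝ) (n : ℕ) (ω : E.Ω n) : ℝ :=
  E.Q n (E.X n ω) (E.X n ω) -
    ![E.Q n (E.eAt β0 n ω) (E.eAt β0 n ω), E.Q n (E.X n ω) (E.eAt β0 n ω)] ⬝ᵥ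
      (E.gammaHat n ω : VarPar).projCoef

open Classical in
/-- The feasible test with weight function `A`. -/
def clcTest (α β0 : ℝ) (A : ℝ → Γ → ℝ × ℝ) (n : ℕ) (ω : E.Ω n) : ℝ :=
  let a := A (E.Dhat β0 n ω) (E.gammaHat n ω)
  if critVal α a (E.gammaHat n ω : VarPar).rho ≤
      a.1 * E.AR β0 n ω ^ 2 + a.2 * E.LM β0 n ω ^ 2 + (1 - a.1 - a.2) * E.LMstar β0 n ω ^ 2
  then 1 else 0

/-- The rotated statistics `𝒰(D̂, γ̂)ᵀ (AR, LM*)ᵀ`. -/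
def rotated (β0 : ℝ) (U : ℝ → Γ → Matrix (Fin 2) (Fin 2) ℝ) (n : ℕ) (ω : E.Ω n) :
    Fin 2 → ℝ :=
  (U (E.Dhat β0 n ω) (E.gammaHat n ω))ᵀ *ᵥ ![E.AR β0 n ω, E.LMstar β0 n ω]

/-- The competitor `φ̃(ÃR², L̃M*², D̂, γ̂)`. -/
def rivalTest (β0 : ℝ) (U : ℝ → Γ → Matrix (Fin 2) (Fin 2) ℝ) (φ : ℝ × ℝ × ℝ → Γ → ℝ)
    (n : ℕ) (ω : E.Ω n) : ℝ :=
  φ (E.rotated β0 U n ω 0 ^ 2, E.rotated β0 U n ω 1 ^ 2, E.Dhat β0 n ω) (E.gammaHat n ω)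

/-- `𝔼[T 1{|D̂ - d| ≤ ε}] / 𝔼[1{|D̂ - d| ≤ ε}]`. -/
def localPower (β0 d : ℝ) (T : ∀ n, E.Ω n → ℝ) (ε : ℝ) (n : ℕ) : ℝ :=
  (∫ ω in {ω | |E.Dhat β0 n ω - d| ≤ ε}, T n ω ∂(E.law n)) /
    (E.law n).real {ω | |E.Dhat β0 n ω - d| ≤ ε}

/-- `lim_{ε → 0} lim_{n → ∞}` of the local power of the test `T` exists and equals `L`. -/
def HasCondPower (β0 d : ℝ) (T : ∀ n, E.Ω n → ℝ) (L : ℝ) : Prop :=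
  ∃ g : ℝ → ℝ,
    (∀ ε : ℝ, 0 < ε → Tendsto (E.localPower β0 d T ε) atTop (𝓝 (g ε))) ∧
    Tendsto g (𝓝[>] 0) (𝓝 L)

/-- `(θ₁, θ₂) = (m₁(Δ), m₂(Δ)) 𝒰` with `Δ = β - β₀`. -/
def theta (β0 : ℝ) (r : VarPar) (U : Matrix (Fin 2) (Fin 2) ℝ) : Fin 2 → ℝ :=
  ![r.m1 (E.β - β0) E.Ctilde, r.m2 (E.β - β0) E.Ctilde] ᵥ* U

end DGP

/-! ### The class of competitors -/

/-- The class `Φ_α`: measurable `[0,1]`-valued functions of `(z₁, z₂, d)` and `r ∈ Γ` with level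
`α` for every `(d, r)` and, for every `r`, continuous at `(z₁, z₂, d, r)` for Lebesgue almost
every `(z₁, z₂, d)`. -/
structure IsLevelTest {Γ : Set VarPar} (α : ℝ) (φ : ℝ × ℝ × ℝ → Γ → ℝ) : Prop where
  measurable : Measurable (Function.uncurry φ)
  mem_Icc : ∀ p r, φ p r ∈ Set.Icc (0 : ℝ) 1
  level : ∀ (d : ℝ) (r : Γ), ∫ z, φ (z.1 ^ 2, z.2 ^ 2, d) r ∂(normal2 0 0) ≤ α
  continuity : ∀ r : Γ, ∀ᵐ p : ℝ × ℝ × ℝ, ContinuousAt (Function.uncurry φ) (p, r)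

/-- The values `d` at which `A(·, r)` and `U(·, r)` are continuous and `φ(·, r)` is continuous at
`(z₁, z₂, d)` for almost every `(z₁, z₂)`. -/
def regularPoints {Γ : Set VarPar} (A : ℝ → Γ → ℝ × ℝ)
    (U : ℝ → Γ → Matrix (Fin 2) (Fin 2) ℝ) (φ : ℝ × ℝ × ℝ → Γ → ℝ) (r : Γ) : Set ℝ :=
  {d | ContinuousAt (fun x => A x r) d ∧ ContinuousAt (fun x => U x r) d ∧
    ∀ᵐ z : ℝ × ℝ, ContinuousAt (fun p => φ p r) (z.1, z.2, d)}

end JackknifeCLC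

end

/-! The problem reduces to a two-dimensional normal shift experiment. The statistics `(D̂, (AR,
LM*))` are an exact function (`jointStat`) of the three quadratic forms, of `γ̂` and of the
concentration parameter. In the limit `D` is the residual of `Q_XX` after projection on the other
two forms, and `LM*` is the residual of `LM` after projection on `AR`. These residuals are
uncorrelated and jointly normal, so `D` is a nondegenerate normal variable independent of `(AR,
LM*)`, which has law `normal2 m₁ m₂` (`map_jointStat`). A Slutsky and continuous mapping argument
for almost surely continuous functions (`tendsto_integral_of_continuousAt`) gives the limits over a
window around `d`. Shrinking the window then gives the power at `D = d` (`DGP.hasCondPower`).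

For fixed `d`, rotating by `𝒰` diagonalizes the combined statistic. The CLC test becomes the test
`q` rejecting when `ν₁ z₁² + ν₂ z₂² ≥ c`, with `ν₁, ν₂ ≥ 0` and `ν₁ + ν₂ = 1`. The competitor
becomes a test `ψ` even in each coordinate, and the mean becomes `(θ₁, θ₂)`. The null rejection
probability of `q` is at least `α`, hence at least that of `ψ`.

(i) Power functions are continuous in the mean, so dominance on a dense set is dominance everywhere.
The acceptance region of `q` is convex. If `ψ` failed to reject on a non-null part of a half-plane
outside that region, its power loss would grow exponentially along the normal direction of the
half-plane, against a bounded gain elsewhere. Hence `ψ = 1` almost everywhere outside the region,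
and the size comparison forces `ψ = q` almost everywhere (`ae_eq_quadTest`).

(ii) Up to a positive factor, the power at `(s, t)` is a Laplace transform under the null. By
evenness the exponential may be replaced by `cosh(s z₁) cosh(t z₂)`. When `s² = b ν₁` and `t² = b
ν₂` this is `1 + (b/2)(ν₁ z₁² + ν₂ z₂²) + O(b²)`. To first order the best test rejects for large `ν₁
z₁² + ν₂ z₂²`, by the Neyman–Pearson argument, and the remainder is uniformly controlled by Gaussian
integrability (`exists_pos_forall_integral_le_quadTest`). -/

noncomputable section

namespace JackknifeCLC

/-! ### A mapping theorem for convergence in distribution -/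

section Mapping

variable {X Y : Type*} [PseudoMetricSpace X] [MeasurableSpace X] [BorelSpace X]
  [PseudoMetricSpace Y]
  {Ω : ℕ → Type*} [∀ n, MeasurableSpace (Ω n)] {P : ∀ n, Measure (Ω n)}
  [∀ n, IsProbabilityMeasure (P n)] {μ : Measure X} [IsProbabilityMeasure μ]
  {ξ : ∀ n, Ω n → X} {η : ∀ n, Ω n → Y} {c : Y} {f : X × Y → ℝ}

/-- The inequality of the portmanteau theorem for the preimage of a closed set under a function
that is almost surely continuous at the limit. -/
theorem limsup_measure_preimage_closed_le
    (hξ : TendstoInDistribution ξ atTop id P μ)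
    (hη : ∀ δ : ℝ, 0 < δ → Tendsto (fun n => P n {ω | δ ≤ dist (η n ω) c}) atTop (𝓝 0))
    (hc : ∀ᵐ x ∂μ, ContinuousAt f (x, c)) {K : Set ℝ} (hK : IsClosed K) :
    limsup (fun n => P n {ω | f (ξ n ω, η n ω) ∈ K}) atTop ≤ μ {x | f (x, c) ∈ K} := by
  -- Taking the closure makes the portmanteau inequality for closed sets applicable to `ξ`. Allowing
  -- all `y` within `1 / (k + 1)` of `c` absorbs the fluctuation of `η`, apart from an event of
  -- vanishing probability.
  let C : ℕ → Set X := fun k =>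
    closure {x | ∃ y, dist y c < 1 / ((k : ℝ) + 1) ∧ f (x, y) ∈ K}
  have hCle : ∀ k, limsup (fun n => P n {ω | f (ξ n ω, η n ω) ∈ K}) atTop ≤ μ (C k) := by
    intro k
    have hδ : (0 : ℝ) < 1 / ((k : ℝ) + 1) := by positivity
    have hle : ∀ n, P n {ω | f (ξ n ω, η n ω) ∈ K}
        ≤ P n {ω | 1 / ((k : ℝ) + 1) ≤ dist (η n ω) c} + (P n).map (ξ n) (C k) := by
      intro n
      rw [Measure.map_apply_of_aemeasurable (hξ.forall_aemeasurable n)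
        isClosed_closure.measurableSet]
      refine (measure_mono ?_).trans (measure_union_le _ _)
      intro ω hω
      by_cases h : 1 / ((k : ℝ) + 1) ≤ dist (η n ω) c
      · exact Or.inl h
      · exact Or.inr (subset_closure ⟨η n ω, not_le.1 h, hω⟩)
    have hport := ProbabilityMeasure.limsup_measure_closed_le_of_tendsto hξ.tendsto
      (isClosed_closure : IsClosed (C k))
    have hport' : limsup (fun n => (P n).map (ξ n) (C k)) atTop ≤ μ (C k) := by
      simpa only [ProbabilityMeasure.coe_mk, Measure.map_id] using hport
    refine ENNReal.le_of_forall_pos_le_add fun ε hε _ => ?_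
    have hsmall : ∀ᶠ n in atTop, P n {ω | 1 / ((k : ℝ) + 1) ≤ dist (η n ω) c} ≤ ε :=
      (hη _ hδ).eventually_le_const (by exact_mod_cast hε)
    calc limsup (fun n => P n {ω | f (ξ n ω, η n ω) ∈ K}) atTop
        ≤ limsup (fun n => (P n).map (ξ n) (C k) + ε) atTop := by
          refine limsup_le_limsup ?_
          filter_upwards [hsmall] with n hn
          rw [add_comm]
          exact (hle n).trans (by gcongr)
      _ = limsup (fun n => (P n).map (ξ n) (C k)) atTop + ε :=
          limsup_add_const _ _ _ (by isBoundedDefault) (by isBoundedDefault)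
      _ ≤ μ (C k) + ε := by gcongr
  have hanti : Antitone C := by
    intro k l hkl
    refine closure_mono ?_
    rintro x ⟨y, hy, hx⟩
    refine ⟨y, hy.trans_le ?_, hx⟩
    gcongr
  have hlim : Tendsto (fun k => μ (C k)) atTop (𝓝 (μ (⋂ k, C k))) :=
    tendsto_measure_iInter_atTop (fun k => isClosed_closure.measurableSet.nullMeasurableSet) hanti
      ⟨0, measure_ne_top _ _⟩
  refine (ge_of_tendsto' hlim hCle).trans (measure_mono_ae ?_)
  filter_upwards [hc] with x hx hmem
  by_contra hnot
  -- If `f` is continuous at `(x, c)` with value outside `K`, it avoids `K` on a product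
  -- neighbourhood. Then `x` cannot lie in the closure `C k` once `1 / (k + 1)` is below the radius
  -- in the second factor.
  have hev : ∀ᶠ p in 𝓝 (x, c), f p ∈ Kᶜ := hx (hK.isOpen_compl.mem_nhds hnot)
  rw [nhds_prod_eq, eventually_prod_iff] at hev
  obtain ⟨p, hp, q, hq, hpq⟩ := hev
  obtain ⟨δ, hδ, hball⟩ := Metric.eventually_nhds_iff.1 hq
  obtain ⟨k, hk⟩ := exists_nat_one_div_lt hδ
  have hxk : x ∈ C k := Set.mem_iInter.1 hmem k
  obtain ⟨x', hx', y, hy, hxy⟩ := mem_closure_iff_nhds.1 hxk _ hp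
  exact hpq hx' (hball (hy.trans hk)) hxy

/-- Slutsky's lemma and the continuous mapping theorem combined, for functions with values in the
unit interval. -/
theorem tendsto_integral_of_continuousAt [MeasurableSpace Y]
    (hξ : TendstoInDistribution ξ atTop id P μ)
    (hηm : ∀ n, Measurable (η n))
    (hη : ∀ δ : ℝ, 0 < δ → Tendsto (fun n => P n {ω | δ ≤ dist (η n ω) c}) atTop (𝓝 0))
    (hf : Measurable f) (hf01 : ∀ p, f p ∈ Set.Icc (0 : ℝ) 1)
    (hc : ∀ᵐ x ∂μ, ContinuousAt f (x, c)) :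
    Tendsto (fun n => ∫ ω, f (ξ n ω, η n ω) ∂(P n)) atTop (𝓝 (∫ x, f (x, c) ∂μ)) := by
  have hm : ∀ n, AEMeasurable (fun ω => f (ξ n ω, η n ω)) (P n) := fun n =>
    hf.comp_aemeasurable ((hξ.forall_aemeasurable n).prodMk (hηm n).aemeasurable)
  have hm0 : AEMeasurable (fun x => f (x, c)) μ :=
    (hf.comp (measurable_id.prodMk measurable_const)).aemeasurable
  let νs : ℕ → ProbabilityMeasure ℝ := fun n =>
    ⟨(P n).map (fun ω => f (ξ n ω, η n ω)), Measure.isProbabilityMeasure_map (hm n)⟩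
  let ν : ProbabilityMeasure ℝ :=
    ⟨μ.map (fun x => f (x, c)), Measure.isProbabilityMeasure_map hm0⟩
  have hν : Tendsto νs atTop (𝓝 ν) := by
    refine tendsto_of_forall_isClosed_limsup_le' fun K hK => ?_
    have := limsup_measure_preimage_closed_le hξ hη hc hK
    simp only [νs, ν, ProbabilityMeasure.coe_mk]
    rw [Measure.map_apply_of_aemeasurable hm0 hK.measurableSet]
    simp_rw [fun n => Measure.map_apply_of_aemeasurable (hm n) hK.measurableSet]
    exact this
  -- Clamping to the unit interval is a bounded continuous test function that leaves the values of
  -- `f` unchanged.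
  let g : BoundedContinuousFunction ℝ ℝ := BoundedContinuousFunction.ofNormedAddCommGroup
    (fun t => max 0 (min t 1)) (by fun_prop) 1 (by
      intro t
      rw [Real.norm_eq_abs, abs_le]
      constructor
      · linarith [le_max_left 0 (min t 1)]
      · exact max_le zero_le_one (min_le_right _ _))
  have hg : ∀ p, g (f p) = f p := by
    intro p
    change max 0 (min (f p) 1) = f p
    rw [min_eq_left (hf01 p).2, max_eq_right (hf01 p).1]
  have := ProbabilityMeasure.tendsto_iff_forall_integral_tendsto.1 hν g
  simp only [νs, ν, ProbabilityMeasure.coe_mk] at this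
  rw [integral_map hm0 g.continuous.aestronglyMeasurable] at this
  simp_rw [fun n => integral_map (hm n) g.continuous.aestronglyMeasurable, hg] at this
  exact this

end Mapping

/-! ### The bivariate normal law -/

instance isProbabilityMeasure_normal2 (μ₁ μ₂ : ℝ) : IsProbabilityMeasure (normal2 μ₁ μ₂) := by
  unfold normal2; infer_instance

theorem normal2_absolutelyContinuous (μ₁ μ₂ : ℝ) : normal2 μ₁ μ₂ ≪ volume :=
  (gaussianReal_absolutelyContinuous μ₁ one_ne_zero).prod
    (gaussianReal_absolutelyContinuous μ₂ one_ne_zero)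

theorem volume_absolutelyContinuous_normal2 (μ₁ μ₂ : ℝ) :
    (volume : Measure (ℝ × ℝ)) ≪ normal2 μ₁ μ₂ :=
  (gaussianReal_absolutelyContinuous' μ₁ one_ne_zero).prod
    (gaussianReal_absolutelyContinuous' μ₂ one_ne_zero)

instance isOpenPosMeasure_normal2 (μ₁ μ₂ : ℝ) : (normal2 μ₁ μ₂).IsOpenPosMeasure :=
  (volume_absolutelyContinuous_normal2 μ₁ μ₂).isOpenPosMeasure

theorem finite_setOf_quadratic_eq {A : ℝ} (hA : A ≠ 0) (B C : ℝ) :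
    {y : ℝ | A * y ^ 2 + B * y = C}.Finite := by
  refine (Set.toFinite {(-B + √(B ^ 2 + 4 * A * C)) / (2 * A),
    (-B - √(B ^ 2 + 4 * A * C)) / (2 * A)}).subset fun y hy => ?_
  have hy' : A * y ^ 2 + B * y = C := hy
  have hsq : B ^ 2 + 4 * A * C = (2 * A * y + B) ^ 2 := by rw [← hy']; ring
  rw [hsq, Real.sqrt_sq_eq_abs]
  have h2A : 2 * A ≠ 0 := by positivity
  rcases abs_choice (2 * A * y + B) with h | h <;> rw [h]
  · left; field_simp; ring
  · right; simp only [Set.mem_singleton_iff]; field_simp; ring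

theorem continuous_combStat :
    Continuous fun p : ((ℝ × ℝ) × ℝ) × ℝ × ℝ => combStat p.1.1 p.1.2 p.2.1 p.2.2 := by
  unfold combStat; fun_prop

theorem measurable_combStat (a : ℝ × ℝ) (ρ : ℝ) :
    Measurable fun z : ℝ × ℝ => combStat a ρ z.1 z.2 := by
  unfold combStat; fun_prop

section CombStat

variable {abar ρ : ℝ} {a : ℝ × ℝ}

theorem combStat_nonneg (habar : abar < 1) (ha : a ∈ weights0 abar) (x y : ℝ) :
    0 ≤ combStat a ρ x y := by
  obtain ⟨h1, -, h2, -, h3⟩ := ha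
  have : 0 ≤ 1 - a.1 - a.2 := by linarith
  unfold combStat; positivity

/-- This is the coefficient of `y²` in `combStat`. It is positive because the bound `abar < 1` keeps
positive weight on `LM*`. No condition on `ρ` is needed, since a square root of a negative number is
`0` by convention. -/
theorem combStat_leading_pos (habar : abar < 1) (ha : a ∈ weights0 abar) :
    0 < a.2 * √(1 - ρ ^ 2) ^ 2 + (1 - a.1 - a.2) := by
  obtain ⟨h1, -, h2, -, h3⟩ := ha
  have : 0 ≤ a.2 * √(1 - ρ ^ 2) ^ 2 := by positivity
  linarith

/-- On each vertical line the level set is the zero set of a genuine quadratic in `y`, hence finite;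
Fubini then gives measure zero. -/
theorem ae_combStat_ne (habar : abar < 1) (ha : a ∈ weights0 abar) (t μ₁ μ₂ : ℝ) :
    ∀ᵐ z ∂(normal2 μ₁ μ₂), combStat a ρ z.1 z.2 ≠ t := by
  have hms : MeasurableSet {z : ℝ × ℝ | combStat a ρ z.1 z.2 = t} :=
    measurable_combStat a ρ (measurableSet_singleton t)
  have := nullSingletonClass_gaussianReal (μ := μ₂) (one_ne_zero : (1 : NNReal) ≠ 0)
  have hnull : normal2 μ₁ μ₂ {z : ℝ × ℝ | combStat a ρ z.1 z.2 = t} = 0 := by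
    rw [normal2, Measure.measure_prod_null hms]
    refine Eventually.of_forall fun x => ?_
    refine Set.Finite.measure_zero ((finite_setOf_quadratic_eq
      (combStat_leading_pos (ρ := ρ) habar ha).ne' (2 * a.2 * ρ * x * √(1 - ρ ^ 2))
      (t - a.1 * x ^ 2 - a.2 * ρ ^ 2 * x ^ 2)).subset fun y hy => ?_) _
    have hy' : combStat a ρ x y = t := hy
    simp only [Set.mem_ofPred_eq]
    rw [← hy', combStat]; ring
  simpa [ae_iff] using hnull

/-! ### Critical values -/

/-- The distribution function of the combined statistic under the null. -/
theorem cdf_map_combStat (a : ℝ × ℝ) (ρ t : ℝ) :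
    cdf ((normal2 0 0).map fun z => combStat a ρ z.1 z.2) t
      = (normal2 0 0).real {z | combStat a ρ z.1 z.2 ≤ t} := by
  have := Measure.isProbabilityMeasure_map (μ := normal2 0 0)
    (measurable_combStat a ρ).aemeasurable
  rw [cdf_eq_real, map_measureReal_apply (measurable_combStat a ρ) measurableSet_Iic]
  rfl

/-- The infimum is attained by right continuity. The strict bounds on `p` make the set nonempty and
bounded below, so the default value of `sInf` never occurs. -/
theorem sInf_le_cdf_le_iff (μ : Measure ℝ) {p t : ℝ} (hp0 : 0 < p) (hp1 : p < 1) :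
    sInf {c | p ≤ cdf μ c} ≤ t ↔ p ≤ cdf μ t := by
  obtain ⟨u, hu⟩ := ((tendsto_cdf_atTop μ).eventually_const_le hp1).exists
  obtain ⟨l, hl⟩ := ((tendsto_cdf_atBot μ).eventually_lt_const hp0).exists
  have hbdd : BddBelow {c | p ≤ cdf μ c} := by
    refine ⟨l, fun c hc => ?_⟩
    by_contra h
    exact absurd (hl.trans_le hc) (not_lt.2 (monotone_cdf μ (not_le.1 h).le))
  refine ⟨fun h => ?_, fun h => csInf_le hbdd h⟩
  have hright : ContinuousWithinAt (cdf μ) (Set.Ioi t) t :=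
    ((cdf μ).right_continuous t).mono Set.Ioi_subset_Ici_self
  refine ge_of_tendsto hright.tendsto ?_
  filter_upwards [self_mem_nhdsWithin] with s hs
  obtain ⟨c, hc, hcs⟩ := exists_lt_of_csInf_lt ⟨u, hu⟩ (h.trans_lt hs)
  exact le_trans hc (monotone_cdf μ hcs.le)

variable {α : ℝ}

/-- This adjunction turns statements about quantiles into statements about distribution functions;
measurability and continuity of the critical value both rest on it. -/
theorem critVal_le_iff (hα0 : 0 < α) (hα1 : α < 1) (a : ℝ × ℝ) (ρ t : ℝ) :
    critVal α a ρ ≤ t ↔ 1 - α ≤ (normal2 0 0).real {z | combStat a ρ z.1 z.2 ≤ t} := by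
  rw [← cdf_map_combStat, ← sInf_le_cdf_le_iff _ (by linarith) (by linarith), critVal]
  simp_rw [cdf_map_combStat]

theorem measurable_critVal (hα0 : 0 < α) (hα1 : α < 1) :
    Measurable fun p : (ℝ × ℝ) × ℝ => critVal α p.1 p.2 := by
  refine measurable_of_Iic fun t => ?_
  have : (fun p : (ℝ × ℝ) × ℝ => critVal α p.1 p.2) ⁻¹' Set.Iic t
      = {p | 1 - α ≤ (normal2 0 0).real {z | combStat p.1 p.2 z.1 z.2 ≤ t}} := by
    ext p; exact critVal_le_iff hα0 hα1 _ _ _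
  rw [this]
  have hs : MeasurableSet {q : ((ℝ × ℝ) × ℝ) × ℝ × ℝ | combStat q.1.1 q.1.2 q.2.1 q.2.2 ≤ t} :=
    measurableSet_le continuous_combStat.measurable measurable_const
  exact measurableSet_le measurable_const
    (measurable_measure_prodMk_left (ν := normal2 0 0) hs).ennreal_toReal

theorem measurable_critVal_comp (hα0 : 0 < α) (hα1 : α < 1) {X : Type*} [MeasurableSpace X]
    {f : X → ℝ × ℝ} {g : X → ℝ} (hf : Measurable f) (hg : Measurable g) :
    Measurable fun x => critVal α (f x) (g x) := by
  have h := (measurable_critVal hα0 hα1).comp (hf.prodMk hg)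
  simp only [Function.comp_def] at h
  exact h

/-- Below the quantile the distribution function is less than `1 - α`, and its left limit there is
the probability of a strict inequality. This lower bound on the size is what makes level-`α`
competitors comparable with the CLC test. -/
theorem le_measureReal_critVal_le (hα0 : 0 < α) (hα1 : α < 1) (a : ℝ × ℝ) (ρ : ℝ) :
    α ≤ (normal2 0 0).real {z | critVal α a ρ ≤ combStat a ρ z.1 z.2} := by
  have hlt : (normal2 0 0).real {z | combStat a ρ z.1 z.2 < critVal α a ρ} ≤ 1 - α := by
    have hlim : Tendsto (fun k : ℕ => (normal2 0 0)
          {z | combStat a ρ z.1 z.2 ≤ critVal α a ρ - 1 / ((k : ℝ) + 1)}) atTop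
        (𝓝 ((normal2 0 0) (⋃ k : ℕ, {z | combStat a ρ z.1 z.2 ≤ critVal α a ρ - 1 / ((k : ℝ) + 1)}))) := by
      refine tendsto_measure_iUnion_atTop fun k l hkl z hz => ?_
      have hz' : combStat a ρ z.1 z.2 ≤ critVal α a ρ - 1 / ((k : ℝ) + 1) := hz
      refine hz'.trans (sub_le_sub_left ?_ _)
      gcongr
    have hU : (⋃ k : ℕ, {z : ℝ × ℝ | combStat a ρ z.1 z.2 ≤ critVal α a ρ - 1 / ((k : ℝ) + 1)})
        = {z | combStat a ρ z.1 z.2 < critVal α a ρ} := by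
      ext z
      simp only [Set.mem_iUnion, Set.mem_ofPred_eq]
      constructor
      · rintro ⟨k, hk⟩
        have : (0 : ℝ) < 1 / ((k : ℝ) + 1) := by positivity
        linarith
      · intro h
        obtain ⟨k, hk⟩ := exists_nat_one_div_lt (sub_pos.2 h)
        exact ⟨k, by linarith⟩
    rw [hU] at hlim
    refine le_of_tendsto' ((ENNReal.tendsto_toReal (measure_ne_top _ _)).comp hlim) fun k => ?_
    by_contra h
    have := (critVal_le_iff hα0 hα1 a ρ (critVal α a ρ - 1 / ((k : ℝ) + 1))).2 (not_le.1 h).le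
    have hk : (0 : ℝ) < 1 / ((k : ℝ) + 1) := by positivity
    linarith
  have hc : {z : ℝ × ℝ | critVal α a ρ ≤ combStat a ρ z.1 z.2}
      = {z | combStat a ρ z.1 z.2 < critVal α a ρ}ᶜ := by ext z; simp
  rw [hc, probReal_compl_eq_one_sub (measurableSet_lt (measurable_combStat a ρ) measurable_const)]
  linarith

theorem critVal_nonneg (hα0 : 0 < α) (hα1 : α < 1) (habar : abar < 1) (ha : a ∈ weights0 abar) :
    0 ≤ critVal α a ρ := by
  by_contra h
  have h1 := (critVal_le_iff hα0 hα1 a ρ (critVal α a ρ)).1 le_rfl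
  have : {z : ℝ × ℝ | combStat a ρ z.1 z.2 ≤ critVal α a ρ} = ∅ := by
    ext z
    simp only [Set.mem_ofPred_eq, Set.mem_empty_iff_false, iff_false, not_le]
    exact (not_le.1 h).trans_le (combStat_nonneg habar ha _ _)
  rw [this, measureReal_empty] at h1
  linarith

/-- For fixed `z` off the level set, the indicator is locally constant in `(a, ρ)`. The level set is
null, so dominated convergence applies. -/
theorem continuousAt_measureReal_combStat_le (habar : abar < 1) (ha : a ∈ weights0 abar) (t : ℝ) :
    ContinuousAt (fun p : (ℝ × ℝ) × ℝ =>
      (normal2 0 0).real {z | combStat p.1 p.2 z.1 z.2 ≤ t}) (a, ρ) := by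
  have hint : ∀ p : (ℝ × ℝ) × ℝ, (normal2 0 0).real {z | combStat p.1 p.2 z.1 z.2 ≤ t}
      = ∫ z, {z : ℝ × ℝ | combStat p.1 p.2 z.1 z.2 ≤ t}.indicator (fun _ => (1 : ℝ)) z
          ∂(normal2 0 0) := fun p =>
    (integral_indicator_one (measurableSet_le (measurable_combStat p.1 p.2)
      measurable_const)).symm
  simp_rw [hint]
  refine continuousAt_of_dominated (bound := fun _ => 1) ?_ ?_ (integrable_const _) ?_
  · refine Eventually.of_forall fun p => ?_
    exact (measurable_const.indicator (measurableSet_le (measurable_combStat p.1 p.2)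
      measurable_const)).aestronglyMeasurable
  · refine Eventually.of_forall fun p => Eventually.of_forall fun z => ?_
    simp only [Set.indicator]; split_ifs <;> simp
  · filter_upwards [ae_combStat_ne (ρ := ρ) habar ha t 0 0] with z hz
    have hcont : ContinuousAt (fun p : (ℝ × ℝ) × ℝ => combStat p.1 p.2 z.1 z.2) (a, ρ) :=
      (continuous_combStat.comp (Continuous.prodMk continuous_id
        (continuous_const (y := z)))).continuousAt
    rcases hz.lt_or_gt with h | h
    · refine (continuousAt_const (y := (1 : ℝ))).congr ?_
      filter_upwards [hcont.eventually_lt_const h] with p hp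
      rw [Set.indicator_of_mem (by exact le_of_lt hp)]
    · refine (continuousAt_const (y := (0 : ℝ))).congr ?_
      filter_upwards [hcont.eventually_const_lt h] with p hp
      rw [Set.indicator_of_notMem (by exact not_le.2 hp)]

theorem measureReal_combStat_le_strictMono (habar : abar < 1) (ha : a ∈ weights0 abar)
    {c t : ℝ} (hc : 0 ≤ c) (hct : c < t) :
    (normal2 0 0).real {z | combStat a ρ z.1 z.2 ≤ c}
      < (normal2 0 0).real {z | combStat a ρ z.1 z.2 ≤ t} := by
  have hm := measurable_combStat a ρ
  have hopen : IsOpen {z : ℝ × ℝ | c < combStat a ρ z.1 z.2 ∧ combStat a ρ z.1 z.2 < t} := by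
    have hcont : Continuous fun z : ℝ × ℝ => combStat a ρ z.1 z.2 := by
      unfold combStat; fun_prop
    exact (isOpen_lt continuous_const hcont).inter (isOpen_lt hcont continuous_const)
  have hA := combStat_leading_pos (ρ := ρ) habar ha
  set A := a.2 * √(1 - ρ ^ 2) ^ 2 + (1 - a.1 - a.2) with hAdef
  have hne : {z : ℝ × ℝ | c < combStat a ρ z.1 z.2 ∧ combStat a ρ z.1 z.2 < t}.Nonempty := by
    -- On the vertical axis the statistic is `A y²`, which takes the midpoint value here; `c ≥ 0`
    -- makes the square root legitimate.
    refine ⟨(0, √(((c + t) / 2) / A)), ?_⟩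
    have : combStat a ρ 0 (√(((c + t) / 2) / A)) = (c + t) / 2 := by
      have h0 : 0 ≤ ((c + t) / 2) / A := div_nonneg (by linarith) hA.le
      calc combStat a ρ 0 (√(((c + t) / 2) / A))
          = A * √(((c + t) / 2) / A) ^ 2 := by rw [combStat, hAdef]; ring
        _ = (c + t) / 2 := by rw [Real.sq_sqrt h0]; field_simp
    simp only [Set.mem_ofPred_eq, this]
    constructor <;> linarith
  have hpos : 0 < (normal2 0 0).real
      {z : ℝ × ℝ | c < combStat a ρ z.1 z.2 ∧ combStat a ρ z.1 z.2 < t} :=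
    ENNReal.toReal_pos (hopen.measure_pos _ hne).ne' (measure_ne_top _ _)
  have hdisj : Disjoint {z : ℝ × ℝ | combStat a ρ z.1 z.2 ≤ c}
      {z : ℝ × ℝ | c < combStat a ρ z.1 z.2 ∧ combStat a ρ z.1 z.2 < t} :=
    Set.disjoint_left.2 fun z hz hz' => absurd hz (not_le.2 hz'.1)
  have hunion := measureReal_union (μ := normal2 0 0) hdisj hopen.measurableSet
  have hle : (normal2 0 0).real ({z : ℝ × ℝ | combStat a ρ z.1 z.2 ≤ c} ∪
      {z : ℝ × ℝ | c < combStat a ρ z.1 z.2 ∧ combStat a ρ z.1 z.2 < t})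
      ≤ (normal2 0 0).real {z | combStat a ρ z.1 z.2 ≤ t} := by
    refine measureReal_mono ?_
    rintro z (hz | hz)
    · exact le_trans hz hct.le
    · exact hz.2.le
  linarith

/-- A quantile is continuous when the distribution function depends continuously on the parameters
and is strictly increasing beyond the quantile. Strict increase is needed only for the upper bound.
-/
theorem continuousAt_critVal (hα0 : 0 < α) (hα1 : α < 1) (habar : abar < 1)
    (ha : a ∈ weights0 abar) :
    ContinuousAt (fun p : (ℝ × ℝ) × ℝ => critVal α p.1 p.2) (a, ρ) := by
  refine tendsto_order.2 ⟨fun b hb => ?_, fun b hb => ?_⟩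
  · have h : (normal2 0 0).real {z | combStat a ρ z.1 z.2 ≤ b} < 1 - α := by
      by_contra h
      exact absurd ((critVal_le_iff hα0 hα1 a ρ b).2 (not_lt.1 h)) (not_le.2 hb)
    filter_upwards [(continuousAt_measureReal_combStat_le habar ha b).eventually_lt_const h]
      with p hp
    by_contra hpb
    exact absurd ((critVal_le_iff hα0 hα1 p.1 p.2 b).1 (not_lt.1 hpb)) (not_le.2 hp)
  · obtain ⟨b', hb', hb'b⟩ := exists_between hb
    have h : 1 - α < (normal2 0 0).real {z | combStat a ρ z.1 z.2 ≤ b'} :=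
      ((critVal_le_iff hα0 hα1 a ρ _).1 le_rfl).trans_lt
        (measureReal_combStat_le_strictMono habar ha (critVal_nonneg hα0 hα1 habar ha) hb')
    filter_upwards [(continuousAt_measureReal_combStat_le habar ha b').eventually_const_lt h]
      with p hp
    exact ((critVal_le_iff hα0 hα1 p.1 p.2 b').2 hp.le).trans_lt hb'b

end CombStat

/-! ### Likelihood ratios in the bivariate normal shift experiment -/

theorem gaussianReal_eq_withDensity (s : ℝ) :
    gaussianReal s 1
      = (gaussianReal 0 1).withDensity fun x => ENNReal.ofReal (Real.exp (s * x - s ^ 2 / 2)) := by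
  rw [gaussianReal_of_var_ne_zero s one_ne_zero, gaussianReal_of_var_ne_zero 0 one_ne_zero,
    ← withDensity_mul _ (measurable_gaussianPDF 0 1) (by fun_prop)]
  congr 1
  ext x
  simp only [Pi.mul_apply, gaussianPDF]
  rw [← ENNReal.ofReal_mul (gaussianPDFReal_nonneg _ _ _)]
  congr 1
  simp only [gaussianPDFReal]
  rw [mul_assoc (√_)⁻¹, ← Real.exp_add]
  congr 2
  simp
  ring

theorem normal2_eq_withDensity (s t : ℝ) :
    normal2 s t = (normal2 0 0).withDensity fun z =>
      ENNReal.ofReal (Real.exp (-(s ^ 2 + t ^ 2) / 2) * Real.exp (s * z.1 + t * z.2)) := by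
  have : SFinite ((gaussianReal 0 1).withDensity
      fun x => ENNReal.ofReal (Real.exp (t * x - t ^ 2 / 2))) := by
    rw [← gaussianReal_eq_withDensity]; infer_instance
  rw [normal2, gaussianReal_eq_withDensity s, gaussianReal_eq_withDensity t,
    prod_withDensity (by fun_prop) (by fun_prop), normal2]
  congr 1
  ext z
  rw [← ENNReal.ofReal_mul (Real.exp_nonneg _), ← Real.exp_add, ← Real.exp_add]
  congr 2
  ring

/-- The positive factor in front depends only on the mean, so comparing two tests at the same mean
amounts to comparing Laplace transforms under the null. -/
theorem integral_normal2 (s t : ℝ) (f : ℝ × ℝ → ℝ) :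
    ∫ z, f z ∂(normal2 s t) = Real.exp (-(s ^ 2 + t ^ 2) / 2) *
      ∫ z, f z * Real.exp (s * z.1 + t * z.2) ∂(normal2 0 0) := by
  rw [normal2_eq_withDensity, integral_withDensity_eq_integral_toReal_smul (by fun_prop)
    (by simp), ← integral_const_mul]
  refine integral_congr_ae (Eventually.of_forall fun z => ?_)
  simp only [smul_eq_mul]
  rw [ENNReal.toReal_ofReal (by positivity)]
  ring

theorem integrable_exp_normal2 (s t : ℝ) :
    Integrable (fun z : ℝ × ℝ => Real.exp (s * z.1 + t * z.2)) (normal2 0 0) := by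
  simp_rw [Real.exp_add]
  exact (integrable_exp_mul_gaussianReal s).mul_prod (integrable_exp_mul_gaussianReal t)

theorem integrable_exp_abs_normal2 (M : ℝ) :
    Integrable (fun z : ℝ × ℝ => Real.exp (M * |z.1|) * Real.exp (M * |z.2|)) (normal2 0 0) := by
  have h : Integrable (fun x : ℝ => Real.exp (M * |x|)) (gaussianReal 0 1) :=
    integrable_exp_mul_abs (X := id) (integrable_exp_mul_gaussianReal M)
      (integrable_exp_mul_gaussianReal (-M))
  exact h.mul_prod h

variable {ψ : ℝ × ℝ → ℝ}

theorem integrable_of_mem_Icc {Ω : Type*} [MeasurableSpace Ω] {μ : Measure Ω} [IsFiniteMeasure μ]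
    {g : Ω → ℝ} (hg : Measurable g) (h01 : ∀ x, g x ∈ Set.Icc (0 : ℝ) 1) : Integrable g μ :=
  Integrable.of_bound hg.aestronglyMeasurable 1 (Eventually.of_forall fun x => by
    rw [Real.norm_eq_abs, abs_le]; exact ⟨by linarith [(h01 x).1], (h01 x).2⟩)

theorem integrable_mul_exp_normal2 (hψ : Measurable ψ) (h01 : ∀ z, |ψ z| ≤ 1) (s t : ℝ) :
    Integrable (fun z => ψ z * Real.exp (s * z.1 + t * z.2)) (normal2 0 0) := by
  refine (integrable_exp_normal2 s t).bdd_mul hψ.aestronglyMeasurable (c := 1) ?_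
  exact Eventually.of_forall h01

/-- The mean enters only through the smooth likelihood ratio, so no continuity of `ψ` is required.
This carries a power inequality from a dense set of means to all means. -/
theorem continuous_integral_normal2 (hψ : Measurable ψ) (h01 : ∀ z, |ψ z| ≤ 1) :
    Continuous fun θ : ℝ × ℝ => ∫ z, ψ z ∂(normal2 θ.1 θ.2) := by
  have heq : (fun θ : ℝ × ℝ => ∫ z, ψ z ∂(normal2 θ.1 θ.2)) = fun θ =>
      Real.exp (-(θ.1 ^ 2 + θ.2 ^ 2) / 2) *
        ∫ z, ψ z * Real.exp (θ.1 * z.1 + θ.2 * z.2) ∂(normal2 0 0) :=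
    funext fun θ => integral_normal2 _ _ _
  rw [heq]
  refine Continuous.mul (by fun_prop) (continuous_iff_continuousAt.2 fun θ => ?_)
  have hbd : ∀ᶠ θ' in 𝓝 θ, |θ'.1| ≤ ‖θ‖ + 1 ∧ |θ'.2| ≤ ‖θ‖ + 1 := by
    filter_upwards [(continuous_norm.tendsto θ).eventually_le_const (lt_add_one ‖θ‖)] with θ' hθ'
    exact ⟨(norm_fst_le θ').trans hθ', (norm_snd_le θ').trans hθ'⟩
  refine continuousAt_of_dominated ?_ ?_ (integrable_exp_abs_normal2 (‖θ‖ + 1)) ?_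
  · exact Eventually.of_forall fun θ' =>
      (hψ.mul (by fun_prop)).aestronglyMeasurable
  · filter_upwards [hbd] with θ' hθ'
    refine Eventually.of_forall fun z => ?_
    rw [norm_mul, Real.norm_eq_abs, Real.norm_eq_abs, Real.abs_exp, ← Real.exp_add]
    refine (mul_le_of_le_one_left (Real.exp_nonneg _) (h01 z)).trans (Real.exp_le_exp.2 ?_)
    have h1 : θ'.1 * z.1 ≤ (‖θ‖ + 1) * |z.1| := (le_abs_self _).trans (by
      rw [abs_mul]; exact mul_le_mul_of_nonneg_right hθ'.1 (abs_nonneg _))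
    have h2 : θ'.2 * z.2 ≤ (‖θ‖ + 1) * |z.2| := (le_abs_self _).trans (by
      rw [abs_mul]; exact mul_le_mul_of_nonneg_right hθ'.2 (abs_nonneg _))
    linarith
  · exact Eventually.of_forall fun z => by fun_prop

theorem integral_normal2_congr {ψ' : ℝ × ℝ → ℝ} (h : ψ =ᵐ[normal2 0 0] ψ') (s t : ℝ) :
    ∫ z, ψ z ∂(normal2 s t) = ∫ z, ψ' z ∂(normal2 s t) :=
  integral_congr_ae (((normal2_absolutelyContinuous s t).trans
    (volume_absolutelyContinuous_normal2 0 0)).ae_eq h)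

/-! ### Admissibility of tests with an elliptic acceptance region -/

/-- The test that rejects for large values of `v z₁² + w z₂²`. -/
def quadTest (v w c : ℝ) : ℝ × ℝ → ℝ :=
  {z | c ≤ v * z.1 ^ 2 + w * z.2 ^ 2}.indicator fun _ => 1

section QuadTest

variable {v w c : ℝ}

theorem quadTest_of_le {z : ℝ × ℝ} (h : c ≤ v * z.1 ^ 2 + w * z.2 ^ 2) :
    quadTest v w c z = 1 := Set.indicator_of_mem (by exact h) _

theorem quadTest_of_lt {z : ℝ × ℝ} (h : v * z.1 ^ 2 + w * z.2 ^ 2 < c) :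
    quadTest v w c z = 0 := Set.indicator_of_notMem (by exact not_le.2 h) _

theorem measurable_quadTest : Measurable (quadTest v w c) :=
  measurable_const.indicator (measurableSet_le measurable_const (by fun_prop))

theorem quadTest_mem_Icc (z : ℝ × ℝ) : quadTest v w c z ∈ Set.Icc (0 : ℝ) 1 := by
  unfold quadTest Set.indicator
  split_ifs <;> simp

theorem integral_quadTest (s t : ℝ) : ∫ z, quadTest v w c z ∂(normal2 s t)
    = (normal2 s t).real {z | c ≤ v * z.1 ^ 2 + w * z.2 ^ 2} :=
  integral_indicator_one (measurableSet_le measurable_const (by fun_prop))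

theorem abs_quadTest_sub_le (h01 : ∀ z, ψ z ∈ Set.Icc (0 : ℝ) 1) (z : ℝ × ℝ) :
    |quadTest v w c z - ψ z| ≤ 1 := by
  have h1 := quadTest_mem_Icc (v := v) (w := w) (c := c) z
  have h2 := h01 z
  rw [abs_le]
  constructor <;> linarith [h1.1, h1.2, h2.1, h2.2]

/-- A half-plane that supports the ellipse `v z₁² + w z₂² ≤ c` lies outside of it. -/
theorem lt_quad_of_lt_bilin (hv : 0 ≤ v) (hw : 0 ≤ w) {x z : ℝ × ℝ}
    (h : √(c * (v * x.1 ^ 2 + w * x.2 ^ 2)) < v * x.1 * z.1 + w * x.2 * z.2) :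
    c < v * z.1 ^ 2 + w * z.2 ^ 2 := by
  by_contra hz
  have hz' := not_lt.1 hz
  have hqx : 0 ≤ v * x.1 ^ 2 + w * x.2 ^ 2 := by positivity
  have hB := Real.lt_sq_of_sqrt_lt h
  have hCS : (v * x.1 * z.1 + w * x.2 * z.2) ^ 2
      ≤ (v * x.1 ^ 2 + w * x.2 ^ 2) * (v * z.1 ^ 2 + w * z.2 ^ 2) := by
    have : 0 ≤ v * w * (x.1 * z.2 - x.2 * z.1) ^ 2 := by positivity
    nlinarith
  nlinarith [mul_le_mul_of_nonneg_left hz' hqx]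

/-- A test that is nowhere less powerful rejects almost surely in every half-plane outside of the
acceptance region. -/
theorem ae_eq_one_of_halfPlane (hψ : Measurable ψ) (h01 : ∀ z, ψ z ∈ Set.Icc (0 : ℝ) 1)
    (hpow : ∀ s t, ∫ z, quadTest v w c z ∂(normal2 s t) ≤ ∫ z, ψ z ∂(normal2 s t))
    {l m k : ℝ} (hH : ∀ z : ℝ × ℝ, k < l * z.1 + m * z.2 → c < v * z.1 ^ 2 + w * z.2 ^ 2) :
    ∀ᵐ z ∂(normal2 0 0), k < l * z.1 + m * z.2 → ψ z = 1 := by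
  have hχ01 : ∀ z, quadTest v w c z ∈ Set.Icc (0 : ℝ) 1 := quadTest_mem_Icc
  have habs : ∀ {g : ℝ × ℝ → ℝ}, (∀ z, g z ∈ Set.Icc (0 : ℝ) 1) → ∀ z, |g z| ≤ 1 :=
    fun hg z => abs_le.2 ⟨by linarith [(hg z).1], (hg z).2⟩
  let H : Set (ℝ × ℝ) := {z | k < l * z.1 + m * z.2}
  have hHm : MeasurableSet H := measurableSet_lt measurable_const (by fun_prop)
  -- `J` weights the failure to reject in the half-plane by the distance to its boundary, up to
  -- scale. The goal is `∫ J = 0`.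
  let J : ℝ × ℝ → ℝ := H.indicator fun z => (1 - ψ z) * (l * z.1 + m * z.2 - k)
  have hJ0 : ∀ z, 0 ≤ J z := fun z => Set.indicator_nonneg (fun z hz => by
    have : k < l * z.1 + m * z.2 := hz
    exact mul_nonneg (by linarith [(h01 z).2]) (by linarith)) z
  have hdiff : ∀ r : ℝ, Integrable (fun z => (quadTest v w c z - ψ z) *
      Real.exp (r * l * z.1 + r * m * z.2)) (normal2 0 0) := fun r =>
    integrable_mul_exp_normal2 (measurable_quadTest.sub hψ) (abs_quadTest_sub_le h01) _ _
  have hJint : Integrable J (normal2 0 0) := by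
    have hle : ∀ z, ‖J z‖ ≤ Real.exp (l * z.1 + m * z.2) * Real.exp (-k) := by
      intro z
      rw [Real.norm_of_nonneg (hJ0 z), ← Real.exp_add]
      by_cases hz : z ∈ H
      · have hz' : k < l * z.1 + m * z.2 := hz
        simp only [J, Set.indicator_of_mem hz]
        have := Real.add_one_le_exp (l * z.1 + m * z.2 + -k)
        nlinarith [(h01 z).1, (h01 z).2]
      · simp only [J, Set.indicator_of_notMem hz]; positivity
    exact ((integrable_exp_normal2 l m).mul_const _).mono'
      (((measurable_const.sub hψ).mul (by fun_prop)).indicator hHm).aestronglyMeasurable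
      (Eventually.of_forall hle)
  have hneg : ∀ r : ℝ, ∫ z, (quadTest v w c z - ψ z) *
      Real.exp (r * l * z.1 + r * m * z.2) ∂(normal2 0 0) ≤ 0 := by
    intro r
    have h := hpow (r * l) (r * m)
    rw [integral_normal2 (r * l) (r * m) ψ, integral_normal2 (r * l) (r * m) (quadTest v w c)] at h
    have h' := le_of_mul_le_mul_left h (Real.exp_pos _)
    simp_rw [sub_mul]
    rw [integral_sub (integrable_mul_exp_normal2 measurable_quadTest (habs hχ01) _ _)
      (integrable_mul_exp_normal2 hψ (habs h01) _ _)]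
    linarith
  have hbound : ∀ r : ℝ, 0 < r → r * ∫ z, J z ∂(normal2 0 0) ≤ 1 := by
    intro r hr
    -- Power is compared at the mean `r (l, m)`, normalized by `exp (-(r k))`. Inside the half-plane
    -- `quadTest` is `1` and the exponential exceeds its argument. Outside, the exponent is
    -- nonpositive, so the loss is at most `1`. Integrating bounds `r ∫ J` by `1` for every `r > 0`.
    have hpt : ∀ z, r * J z - 1 ≤ Real.exp (-(r * k)) * ((quadTest v w c z - ψ z) *
        Real.exp (r * l * z.1 + r * m * z.2)) := by
      intro z
      have hexp : Real.exp (-(r * k)) * ((quadTest v w c z - ψ z) *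
          Real.exp (r * l * z.1 + r * m * z.2))
          = (quadTest v w c z - ψ z) * Real.exp (r * (l * z.1 + m * z.2 - k)) := by
        rw [mul_left_comm, ← Real.exp_add]; congr 2; ring
      rw [hexp]
      by_cases hz : z ∈ H
      · simp only [J, Set.indicator_of_mem hz]
        rw [quadTest_of_le (hH z hz).le]
        have := Real.add_one_le_exp (r * (l * z.1 + m * z.2 - k))
        have h1 : 0 ≤ 1 - ψ z := by linarith [(h01 z).2]
        nlinarith
      · simp only [J, Set.indicator_of_notMem hz]
        have hz' : l * z.1 + m * z.2 ≤ k := not_lt.1 hz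
        have hle1 : Real.exp (r * (l * z.1 + m * z.2 - k)) ≤ 1 :=
          Real.exp_le_one_iff.2 (mul_nonpos_of_nonneg_of_nonpos hr.le (by linarith))
        have := (abs_le.1 (abs_quadTest_sub_le (v := v) (w := w) (c := c) h01 z)).1
        have h0 := Real.exp_nonneg (r * (l * z.1 + m * z.2 - k))
        nlinarith
    have hi := integral_mono ((hJint.const_mul r).sub (integrable_const 1))
      ((hdiff r).const_mul (Real.exp (-(r * k)))) hpt
    rw [integral_const_mul] at hi
    simp only [Pi.sub_apply] at hi
    rw [integral_sub (hJint.const_mul r) (integrable_const 1), integral_const_mul] at hi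
    have := mul_nonpos_of_nonneg_of_nonpos (Real.exp_nonneg (-(r * k))) (hneg r)
    simp only [integral_const, probReal_univ, smul_eq_mul, mul_one] at hi
    linarith
  have hJzero : ∫ z, J z ∂(normal2 0 0) = 0 := by
    refine le_antisymm ?_ (integral_nonneg hJ0)
    by_contra h
    have hpos := not_le.1 h
    have := hbound (2 / ∫ z, J z ∂(normal2 0 0)) (by positivity)
    rw [div_mul_cancel₀ _ hpos.ne'] at this
    linarith
  have hae := (integral_eq_zero_iff_of_nonneg hJ0 hJint).1 hJzero
  filter_upwards [hae] with z hz hzH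
  simp only [J, Set.indicator_of_mem (show z ∈ H from hzH), Pi.zero_apply] at hz
  rcases mul_eq_zero.1 hz with h | h <;> linarith

/-- A test that is of no larger size and nowhere less powerful than the test rejecting outside of
an ellipse coincides with it. -/
theorem ae_eq_quadTest (hv : 0 ≤ v) (hw : 0 ≤ w) (hc : 0 ≤ c)
    (hne : ∀ᵐ z ∂(normal2 0 0), v * z.1 ^ 2 + w * z.2 ^ 2 ≠ c)
    (hψ : Measurable ψ) (h01 : ∀ z, ψ z ∈ Set.Icc (0 : ℝ) 1)
    (hlevel : ∫ z, ψ z ∂(normal2 0 0) ≤ ∫ z, quadTest v w c z ∂(normal2 0 0))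
    (hpow : ∀ s t, ∫ z, quadTest v w c z ∂(normal2 s t) ≤ ∫ z, ψ z ∂(normal2 s t)) :
    quadTest v w c =ᵐ[normal2 0 0] ψ := by
  have hnull : normal2 0 0 {z | c < v * z.1 ^ 2 + w * z.2 ^ 2 ∧ ψ z ≠ 1} = 0 := by
    refine measure_null_of_locally_null _ fun x hx => ?_
    -- The half-plane has normal direction `(v x₁, w x₂)`, and Cauchy–Schwarz for the form `v z₁² +
    -- w z₂²` places it outside the acceptance region. It contains `x` because the form exceeds `c`
    -- there. A degenerate form, whose acceptance region is a strip, is covered too. Countably many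
    -- such neighbourhoods suffice for nullity.
    let k := √(c * (v * x.1 ^ 2 + w * x.2 ^ 2))
    have hopen : IsOpen {z : ℝ × ℝ | k < (v * x.1) * z.1 + (w * x.2) * z.2} :=
      isOpen_lt continuous_const (by fun_prop)
    have hxk : k < (v * x.1) * x.1 + (w * x.2) * x.2 := by
      have hx1 : c < v * x.1 ^ 2 + w * x.2 ^ 2 := hx.1
      have : (v * x.1) * x.1 + (w * x.2) * x.2 = v * x.1 ^ 2 + w * x.2 ^ 2 := by ring
      rw [this, Real.sqrt_lt' (by linarith)]
      nlinarith
    have hae := ae_eq_one_of_halfPlane hψ h01 hpow (l := v * x.1) (m := w * x.2) (k := k)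
      fun z hz => lt_quad_of_lt_bilin hv hw hz
    refine ⟨{z | k < (v * x.1) * z.1 + (w * x.2) * z.2} ∩
      {z | c < v * z.1 ^ 2 + w * z.2 ^ 2 ∧ ψ z ≠ 1}, ?_, ?_⟩
    · exact Filter.inter_mem (mem_nhdsWithin_of_mem_nhds (hopen.mem_nhds hxk)) self_mem_nhdsWithin
    · refine measure_mono_null ?_ (ae_iff.1 hae)
      rintro z ⟨hz1, hz2⟩ hz3
      exact hz2.2 (hz3 hz1)
  have hle : quadTest v w c ≤ᵐ[normal2 0 0] ψ := by
    have h1 : ∀ᵐ z ∂(normal2 0 0), ¬ (c < v * z.1 ^ 2 + w * z.2 ^ 2 ∧ ψ z ≠ 1) := by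
      rw [ae_iff]; simpa using hnull
    filter_upwards [h1, hne] with z hz hzne
    rcases lt_or_gt_of_ne hzne with h | h
    · rw [quadTest_of_lt h]; exact (h01 z).1
    · rw [quadTest_of_le h.le]
      by_contra hlt
      exact hz ⟨h, fun h1 => hlt h1.ge⟩
  have hiq := integrable_of_mem_Icc (μ := normal2 0 0)
    (measurable_quadTest (v := v) (w := w) (c := c)) quadTest_mem_Icc
  have hiψ := integrable_of_mem_Icc (μ := normal2 0 0) hψ h01
  -- Almost everywhere `quadTest ≤ ψ`, while the size comparison bounds the integrals in the
  -- opposite direction.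
  exact (integral_eq_iff_of_ae_le hiq hiψ hle).1 (le_antisymm (integral_mono_ae hiq hiψ hle) hlevel)

end QuadTest

/-! ### Optimality against small alternatives -/

theorem one_add_half_sq_le_cosh (x : ℝ) : 1 + x ^ 2 / 2 ≤ Real.cosh x := by
  have h : Real.cosh x = 1 + 2 * Real.sinh (x / 2) ^ 2 := by
    have := Real.cosh_two_mul (x / 2)
    rw [show 2 * (x / 2) = x by ring, Real.cosh_sq] at this
    linarith
  have hs : (x / 2) ^ 2 ≤ Real.sinh (x / 2) ^ 2 := by
    rw [sq_le_sq]
    rcases le_total 0 (x / 2) with h0 | h0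
    · rw [abs_of_nonneg h0, abs_of_nonneg (Real.sinh_nonneg_iff.2 h0)]
      exact Real.self_le_sinh_iff.2 h0
    · rw [abs_of_nonpos h0, abs_of_nonpos (Real.sinh_nonpos_iff.2 h0)]
      exact neg_le_neg (Real.sinh_le_self_iff.2 h0)
  rw [h]; nlinarith

/-- With `p = (x² + y²) / 2`, the product lies between `1 + p` and `exp p`. The gap is controlled by
applying `exp p - 1 ≤ p exp p` twice. -/
theorem abs_cosh_mul_cosh_sub_le (x y : ℝ) :
    |Real.cosh x * Real.cosh y - 1 - (x ^ 2 + y ^ 2) / 2|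
      ≤ ((x ^ 2 + y ^ 2) / 2) ^ 2 * Real.exp ((x ^ 2 + y ^ 2) / 2) := by
  have hx := one_add_half_sq_le_cosh x
  have hy := one_add_half_sq_le_cosh y
  have hlow : 1 + (x ^ 2 + y ^ 2) / 2 ≤ Real.cosh x * Real.cosh y := by
    have := mul_le_mul hx hy (by positivity) (Real.cosh_pos x).le
    nlinarith [mul_nonneg (sq_nonneg x) (sq_nonneg y)]
  have hup : Real.cosh x * Real.cosh y ≤ Real.exp ((x ^ 2 + y ^ 2) / 2) := by
    rw [add_div, Real.exp_add]
    exact mul_le_mul (Real.cosh_le_exp_half_sq x) (Real.cosh_le_exp_half_sq y)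
      (Real.cosh_pos y).le (Real.exp_nonneg _)
  set p := (x ^ 2 + y ^ 2) / 2 with hp
  have hp0 : 0 ≤ p := by positivity
  have h1 : Real.exp p - 1 ≤ p * Real.exp p := by
    have h := Real.add_one_le_exp (-p)
    have h2 : Real.exp (-p) * Real.exp p = 1 := by rw [← Real.exp_add]; simp
    nlinarith [Real.exp_pos p]
  rw [abs_of_nonneg (by linarith)]
  nlinarith

theorem map_neg_fst_normal2 : (normal2 0 0).map (fun z => (-z.1, z.2)) = normal2 0 0 := by
  have := Measure.map_prod_map (gaussianReal 0 1) (gaussianReal 0 1)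
    (f := fun x : ℝ => -x) (g := id) measurable_neg measurable_id
  rw [gaussianReal_map_neg, Measure.map_id, neg_zero] at this
  exact this.symm

theorem map_neg_snd_normal2 : (normal2 0 0).map (fun z => (z.1, -z.2)) = normal2 0 0 := by
  have := Measure.map_prod_map (gaussianReal 0 1) (gaussianReal 0 1)
    (f := id) (g := fun x : ℝ => -x) measurable_id measurable_neg
  rw [gaussianReal_map_neg, Measure.map_id, neg_zero] at this
  exact this.symm

/-- The null law and `g` are invariant under both sign changes. Averaging the exponential over the
four sign patterns gives the product of hyperbolic cosines and removes the odd terms. -/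
theorem integral_mul_exp_eq_cosh {g : ℝ × ℝ → ℝ} (hg : Measurable g) (hg1 : ∀ z, |g z| ≤ 1)
    (hfst : ∀ z, g (-z.1, z.2) = g z) (hsnd : ∀ z, g (z.1, -z.2) = g z) (s t : ℝ) :
    Integrable (fun z => g z * (Real.cosh (s * z.1) * Real.cosh (t * z.2))) (normal2 0 0) ∧
    ∫ z, g z * Real.exp (s * z.1 + t * z.2) ∂(normal2 0 0)
      = ∫ z, g z * (Real.cosh (s * z.1) * Real.cosh (t * z.2)) ∂(normal2 0 0) := by
  let F : ℝ → ℝ → ℝ := fun s t => ∫ z, g z * Real.exp (s * z.1 + t * z.2) ∂(normal2 0 0)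
  have hmeas : ∀ s t : ℝ, Measurable fun z : ℝ × ℝ => g z * Real.exp (s * z.1 + t * z.2) :=
    fun s t => hg.mul (by fun_prop)
  have h1 : ∀ s t, F (-s) t = F s t := by
    intro s t
    simp only [F]
    conv_lhs => rw [← map_neg_fst_normal2]
    rw [integral_map (by fun_prop) (hmeas _ _).aestronglyMeasurable]
    simp [hfst]
  have h2 : ∀ s t, F s (-t) = F s t := by
    intro s t
    simp only [F]
    conv_lhs => rw [← map_neg_snd_normal2]
    rw [integral_map (by fun_prop) (hmeas _ _).aestronglyMeasurable]
    simp [hsnd]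
  have hi : ∀ s t, Integrable (fun z => g z * Real.exp (s * z.1 + t * z.2)) (normal2 0 0) :=
    integrable_mul_exp_normal2 hg hg1
  have hi₁ : Integrable (fun z => g z * Real.exp (s * z.1 + t * z.2)
      + g z * Real.exp (-s * z.1 + t * z.2)) (normal2 0 0) := (hi s t).add (hi (-s) t)
  have hi₂ : Integrable (fun z => g z * Real.exp (s * z.1 + -t * z.2)
      + g z * Real.exp (-s * z.1 + -t * z.2)) (normal2 0 0) := (hi s (-t)).add (hi (-s) (-t))
  have hpt : (fun z => g z * (Real.cosh (s * z.1) * Real.cosh (t * z.2)))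
      = fun z => 4⁻¹ * ((g z * Real.exp (s * z.1 + t * z.2) + g z * Real.exp (-s * z.1 + t * z.2))
        + (g z * Real.exp (s * z.1 + -t * z.2) + g z * Real.exp (-s * z.1 + -t * z.2))) := by
    ext z
    simp only [Real.cosh_eq, Real.exp_add, neg_mul]
    ring
  rw [hpt]
  refine ⟨(hi₁.add hi₂).const_mul _, ?_⟩
  rw [integral_const_mul, integral_add hi₁ hi₂,
    integral_add (hi s t) (hi (-s) t), integral_add (hi s (-t)) (hi (-s) (-t))]
  change F s t = 4⁻¹ * ((F s t + F (-s) t) + (F s (-t) + F (-s) (-t)))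
  rw [h1 s (-t), h2, h1]
  ring

instance isGaussian_normal2 (μ₁ μ₂ : ℝ) : IsGaussian (normal2 μ₁ μ₂) := by
  unfold normal2; infer_instance

section QuadTest

variable {v w c : ℝ} {ψ : ℝ × ℝ → ℝ}

theorem quad_le_norm_sq (hv : 0 ≤ v) (hw : 0 ≤ w) (hvw : v + w = 1) (z : ℝ × ℝ) :
    v * z.1 ^ 2 + w * z.2 ^ 2 ≤ ‖z‖ ^ 2 := by
  have h1 : z.1 ^ 2 ≤ ‖z‖ ^ 2 := by
    rw [← sq_abs]; exact pow_le_pow_left₀ (abs_nonneg _) (norm_fst_le z) 2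
  have h2 : z.2 ^ 2 ≤ ‖z‖ ^ 2 := by
    rw [← sq_abs]; exact pow_le_pow_left₀ (abs_nonneg _) (norm_snd_le z) 2
  calc v * z.1 ^ 2 + w * z.2 ^ 2 ≤ v * ‖z‖ ^ 2 + w * ‖z‖ ^ 2 := by gcongr
    _ = ‖z‖ ^ 2 := by rw [← add_mul, hvw, one_mul]

/-- This is the pointwise Neyman–Pearson inequality: `quadTest` is the largest test where the second
factor is nonnegative and the smallest where it is negative. -/
theorem quadTest_sub_mul_nonneg (h01 : ∀ z, ψ z ∈ Set.Icc (0 : ℝ) 1) (z : ℝ × ℝ) :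
    0 ≤ (quadTest v w c z - ψ z) * (v * z.1 ^ 2 + w * z.2 ^ 2 - c) := by
  rcases lt_or_ge (v * z.1 ^ 2 + w * z.2 ^ 2) c with h | h
  · rw [quadTest_of_lt h]
    exact mul_nonneg_of_nonpos_of_nonpos (by linarith [(h01 z).1]) (by linarith)
  · rw [quadTest_of_le h]
    exact mul_nonneg (by linarith [(h01 z).2]) (by linarith)

/-- With `D = quadTest - ψ` and `q` the quadratic form, the power difference is, up to a positive
factor, `∫ D + (b/2) ∫ D q + O(b²)`. Here `∫ D ≥ 0` by the size comparison and `∫ D q = κ + c ∫ D`,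
with `κ ≥ 0` by Neyman–Pearson. Either `κ > 0` and the linear term dominates for small `b`, or `κ =
0` and the two tests agree almost everywhere. -/
theorem exists_pos_forall_integral_le_quadTest (hv : 0 ≤ v) (hw : 0 ≤ w) (hvw : v + w = 1)
    (hc : 0 ≤ c) (hne : ∀ᵐ z ∂(normal2 0 0), v * z.1 ^ 2 + w * z.2 ^ 2 ≠ c)
    (hψ : Measurable ψ) (h01 : ∀ z, ψ z ∈ Set.Icc (0 : ℝ) 1)
    (hfst : ∀ z, ψ (-z.1, z.2) = ψ z) (hsnd : ∀ z, ψ (z.1, -z.2) = ψ z)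
    (hlevel : ∫ z, ψ z ∂(normal2 0 0) ≤ ∫ z, quadTest v w c z ∂(normal2 0 0)) :
    ∃ bbar : ℝ, 0 < bbar ∧ ∀ b : ℝ, 0 < b → b < bbar → ∀ s t : ℝ, s ^ 2 = b * v → t ^ 2 = b * w →
      ∫ z, ψ z ∂(normal2 s t) ≤ ∫ z, quadTest v w c z ∂(normal2 s t) := by
  -- Fernique's theorem supplies one exponential-square bound that dominates all remainders.
  obtain ⟨C, hC, hCint⟩ := IsGaussian.exists_integrable_exp_sq (normal2 0 0)
  let q : ℝ × ℝ → ℝ := fun z => v * z.1 ^ 2 + w * z.2 ^ 2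
  let D : ℝ × ℝ → ℝ := fun z => quadTest v w c z - ψ z
  have hDm : Measurable D := measurable_quadTest.sub hψ
  have hD1 : ∀ z, |D z| ≤ 1 := abs_quadTest_sub_le h01
  have hq0 : ∀ z, 0 ≤ q z := fun z => by positivity
  have hqle : ∀ z, q z ≤ ‖z‖ ^ 2 := quad_le_norm_sq hv hw hvw
  have hqint : Integrable q (normal2 0 0) := by
    refine (hCint.const_mul C⁻¹).mono' (by fun_prop) (Eventually.of_forall fun z => ?_)
    rw [Real.norm_of_nonneg (hq0 z)]
    have h1 := Real.add_one_le_exp (C * ‖z‖ ^ 2)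
    rw [inv_mul_eq_div, le_div_iff₀ hC]
    nlinarith [hqle z]
  have hDint : Integrable D (normal2 0 0) :=
    Integrable.of_bound hDm.aestronglyMeasurable 1 (Eventually.of_forall hD1)
  have hDq : Integrable (fun z => D z * q z) (normal2 0 0) :=
    hqint.bdd_mul hDm.aestronglyMeasurable (Eventually.of_forall hD1)
  have hκeq : ∫ z, D z * (q z - c) ∂(normal2 0 0)
      = ∫ z, D z * q z ∂(normal2 0 0) - c * ∫ z, D z ∂(normal2 0 0) := by
    rw [← integral_const_mul, ← integral_sub hDq (hDint.const_mul c)]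
    congr 1; ext z; ring
  have hκint : Integrable (fun z => D z * (q z - c)) (normal2 0 0) := by
    refine (hDq.sub (hDint.const_mul c)).congr (Eventually.of_forall fun z => ?_)
    simp only [Pi.sub_apply]; ring
  have hD0 : 0 ≤ ∫ z, D z ∂(normal2 0 0) := by
    rw [integral_sub (integrable_of_mem_Icc measurable_quadTest quadTest_mem_Icc)
      (integrable_of_mem_Icc hψ h01)]
    linarith
  have hκ0 : 0 ≤ ∫ z, D z * (q z - c) ∂(normal2 0 0) :=
    integral_nonneg (quadTest_sub_mul_nonneg h01)
  rcases hκ0.eq_or_lt with hκ | hκ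
  · have hae := (integral_eq_zero_iff_of_nonneg (quadTest_sub_mul_nonneg h01) hκint).1 hκ.symm
    have heq : ψ =ᵐ[normal2 0 0] quadTest v w c := by
      filter_upwards [hae, hne] with z hz hzne
      rcases mul_eq_zero.1 hz with h | h
      · linarith
      · exact absurd (by linarith) hzne
    exact ⟨1, one_pos, fun b _ _ s t _ _ => (integral_normal2_congr heq s t).le⟩
  set κ := ∫ z, D z * (q z - c) ∂(normal2 0 0) with hκdef
  -- Half of the exponent of `G` dominates `exp (b q / 2)` when `b ≤ C`. The other half, with the
  -- factor `2 / C²`, dominates `q² / 4` through `x² / 2 ≤ exp x` at `x = C ‖z‖² / 2`.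
  let G : ℝ × ℝ → ℝ := fun z => 2 / C ^ 2 * Real.exp (C * ‖z‖ ^ 2)
  have hGint : Integrable G (normal2 0 0) := hCint.const_mul _
  have hG0 : ∀ z, 0 ≤ G z := fun z => by positivity
  set M := ∫ z, G z ∂(normal2 0 0) with hM
  have hM0 : 0 ≤ M := integral_nonneg hG0
  -- The second bound yields `b² M ≤ b κ / 2`, so the remainder is absorbed by the linear term; `M +
  -- 1` avoids division by zero.
  refine ⟨min C (κ / (2 * (M + 1))), lt_min hC (by positivity), fun b hb hbb s t hs ht => ?_⟩
  have hbC : b ≤ C := (hbb.trans_le (min_le_left _ _)).le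
  have hbκ : b * (2 * (M + 1)) ≤ κ :=
    (le_div_iff₀ (by positivity)).1 (hbb.trans_le (min_le_right _ _)).le
  have hpt : ∀ z, D z + b / 2 * (D z * q z) - b ^ 2 * G z
      ≤ D z * (Real.cosh (s * z.1) * Real.cosh (t * z.2)) := by
    intro z
    have hp : ((s * z.1) ^ 2 + (t * z.2) ^ 2) / 2 = b / 2 * q z := by
      rw [mul_pow, mul_pow, hs, ht]; ring
    have hbd := abs_cosh_mul_cosh_sub_le (s * z.1) (t * z.2)
    rw [hp] at hbd
    have hrem : (b / 2 * q z) ^ 2 * Real.exp (b / 2 * q z) ≤ b ^ 2 * G z := by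
      have hx0 : 0 ≤ ‖z‖ ^ 2 := by positivity
      have he : Real.exp (b / 2 * q z) ≤ Real.exp (C / 2 * ‖z‖ ^ 2) := by
        refine Real.exp_le_exp.2 (mul_le_mul ?_ (hqle z) (hq0 z) (by positivity))
        linarith
      have hquad := Real.quadratic_le_exp_of_nonneg (x := C / 2 * ‖z‖ ^ 2) (by positivity)
      have hq2 : q z ^ 2 / 4 ≤ 2 / C ^ 2 * Real.exp (C / 2 * ‖z‖ ^ 2) := by
        have hq2' : q z ^ 2 ≤ (‖z‖ ^ 2) ^ 2 := pow_le_pow_left₀ (hq0 z) (hqle z) 2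
        rw [div_mul_eq_mul_div, le_div_iff₀ (by positivity)]
        have : 0 ≤ C / 2 * ‖z‖ ^ 2 := by positivity
        nlinarith [mul_le_mul_of_nonneg_left hq2' (sq_nonneg C)]
      calc (b / 2 * q z) ^ 2 * Real.exp (b / 2 * q z)
          = b ^ 2 * (q z ^ 2 / 4 * Real.exp (b / 2 * q z)) := by ring
        _ ≤ b ^ 2 * (2 / C ^ 2 * Real.exp (C / 2 * ‖z‖ ^ 2) * Real.exp (C / 2 * ‖z‖ ^ 2)) := by
            gcongr
        _ = b ^ 2 * G z := by
            simp only [G]; rw [mul_assoc, ← Real.exp_add]; congr 3; ring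
    have hDabs : |D z * (Real.cosh (s * z.1) * Real.cosh (t * z.2) - 1 - b / 2 * q z)|
        ≤ b ^ 2 * G z := by
      rw [abs_mul]
      exact (mul_le_of_le_one_left (abs_nonneg _) (hD1 z)).trans (hbd.trans hrem)
    have := (abs_le.1 hDabs).1
    nlinarith
  have hquadfst : ∀ z : ℝ × ℝ, quadTest v w c (-z.1, z.2) = quadTest v w c z := fun z => by
    simp [quadTest, Set.indicator]
  have hquadsnd : ∀ z : ℝ × ℝ, quadTest v w c (z.1, -z.2) = quadTest v w c z := fun z => by
    simp [quadTest, Set.indicator]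
  obtain ⟨hci, hcosh⟩ := integral_mul_exp_eq_cosh hDm hD1
    (fun z => by simp only [D, hfst, hquadfst]) (fun z => by simp only [D, hsnd, hquadsnd]) s t
  have hi₁ : Integrable (fun z => D z + b / 2 * (D z * q z)) (normal2 0 0) :=
    hDint.add (hDq.const_mul (b / 2))
  have hmono := integral_mono (hi₁.sub (hGint.const_mul (b ^ 2))) hci hpt
  rw [← hcosh] at hmono
  simp only [Pi.sub_apply] at hmono
  rw [integral_sub hi₁ (hGint.const_mul (b ^ 2)), integral_const_mul,
    integral_add hDint (hDq.const_mul (b / 2)), integral_const_mul, ← hM] at hmono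
  have hpos : 0 ≤ ∫ z, D z * Real.exp (s * z.1 + t * z.2) ∂(normal2 0 0) := by
    refine le_trans ?_ hmono
    have h1 : 0 ≤ b * c * ∫ z, D z ∂(normal2 0 0) := by positivity
    have h2 : b * (b * (2 * (M + 1))) ≤ b * κ := mul_le_mul_of_nonneg_left hbκ hb.le
    nlinarith [sq_nonneg b]
  rw [integral_normal2 s t ψ, integral_normal2 s t (quadTest v w c)]
  refine mul_le_mul_of_nonneg_left ?_ (Real.exp_nonneg _)
  have habs : ∀ {g : ℝ × ℝ → ℝ}, (∀ z, g z ∈ Set.Icc (0 : ℝ) 1) → ∀ z, |g z| ≤ 1 :=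
    fun hg z => abs_le.2 ⟨by linarith [(hg z).1], (hg z).2⟩
  simp only [D, sub_mul] at hpos
  rw [integral_sub (integrable_mul_exp_normal2 measurable_quadTest (habs quadTest_mem_Icc) _ _)
    (integrable_mul_exp_normal2 hψ (habs h01) _ _)] at hpos
  linarith

end QuadTest

/-! ### Uncorrelated jointly normal variables -/

section Uncorrelated

variable {Ω : Type*} [MeasurableSpace Ω] {P : Measure Ω} {X Y Z : Ω → ℝ} {m₁ m₂ : ℝ}

theorem map_prodMk_eq_normal2 (h : HasGaussianLaw (fun ω => (X ω, Y ω)) P)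
    (hXY : cov[X, Y; P] = 0) (hX : ∫ ω, X ω ∂P = m₁) (hY : ∫ ω, Y ω ∂P = m₂)
    (hvX : Var[X; P] = 1) (hvY : Var[Y; P] = 1) :
    P.map (fun ω => (X ω, Y ω)) = normal2 m₁ m₂ := by
  have := h.isProbabilityMeasure
  have hind := h.indepFun_of_covariance_eq_zero hXY
  rw [(indepFun_iff_map_prod_eq_prod_map_map h.fst.aemeasurable h.snd.aemeasurable).1 hind,
    h.fst.map_eq_gaussianReal, h.snd.map_eq_gaussianReal, hX, hY, hvX, hvY, Real.toNNReal_one,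
    normal2]

/-- Uncorrelated components of a joint Gaussian vector are independent. Independence of `Z` from the
pair is what makes conditioning on `D` leave the law of `(AR, LM*)` unchanged. -/
theorem map_prodMk_eq_prod_normal2 (h : HasGaussianLaw (fun ω => (Z ω, (X ω, Y ω))) P)
    (hXY : cov[X, Y; P] = 0) (hZX : cov[Z, X; P] = 0) (hZY : cov[Z, Y; P] = 0)
    (hX : ∫ ω, X ω ∂P = m₁) (hY : ∫ ω, Y ω ∂P = m₂)
    (hvX : Var[X; P] = 1) (hvY : Var[Y; P] = 1) :
    P.map (fun ω => (Z ω, (X ω, Y ω)))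
      = (gaussianReal (∫ ω, Z ω ∂P) Var[Z; P].toNNReal).prod (normal2 m₁ m₂) := by
  have := h.isProbabilityMeasure
  have hind : IndepFun Z (fun ω => (X ω, Y ω)) P := by
    refine h.indepFun_of_covariance_strongDual fun L₁ L₂ => ?_
    have h1 : L₁ ∘ Z = fun ω => L₁ 1 * Z ω := by
      ext ω
      have := L₁.map_smul (Z ω) 1
      simp only [smul_eq_mul, mul_one] at this
      simp only [Function.comp_apply, this, mul_comm]
    have h2 : (L₂ ∘ fun ω => (X ω, Y ω))
        = (fun ω => L₂ (1, 0) * X ω) + fun ω => L₂ (0, 1) * Y ω := by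
      ext ω
      have : (X ω, Y ω) = X ω • ((1 : ℝ), (0 : ℝ)) + Y ω • ((0 : ℝ), (1 : ℝ)) := by simp
      simp only [Function.comp_apply, Pi.add_apply]
      rw [this, map_add, map_smul, map_smul]
      simp only [smul_eq_mul, mul_comm]
    have hZ2 := h.fst.memLp_two
    have hX2 := h.snd.fst.memLp_two
    have hY2 := h.snd.snd.memLp_two
    rw [h1, h2, covariance_const_mul_left, covariance_add_right hZ2 (hX2.const_mul _)
      (hY2.const_mul _), covariance_const_mul_right, covariance_const_mul_right, hZX, hZY]
    simp
  rw [(indepFun_iff_map_prod_eq_prod_map_map h.fst.aemeasurable h.snd.aemeasurable).1 hind,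
    h.fst.map_eq_gaussianReal, map_prodMk_eq_normal2 h.snd hXY hX hY hvX hvY]

end Uncorrelated

/-! ### Rotations -/

theorem cov_linear_normal2 (m₁ m₂ a b a' b' : ℝ) :
    cov[fun z => a * z.1 + b * z.2, fun z => a' * z.1 + b' * z.2; normal2 m₁ m₂]
      = a * a' + b * b' := by
  have hid : ∀ m, MemLp (fun x : ℝ => x) 2 (gaussianReal m 1) := fun m =>
    IsGaussian.memLp_two_id
  have h1 : MemLp (fun z : ℝ × ℝ => z.1) 2 (normal2 m₁ m₂) :=
    (hid m₁).comp_measurePreserving measurePreserving_fst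
  have h2 : MemLp (fun z : ℝ × ℝ => z.2) 2 (normal2 m₁ m₂) :=
    (hid m₂).comp_measurePreserving measurePreserving_snd
  have hc : cov[fun z : ℝ × ℝ => z.1, fun z => z.2; normal2 m₁ m₂] = 0 :=
    covariance_fst_snd_prod (hid m₁) (hid m₂)
  have hv1 : Var[fun z : ℝ × ℝ => z.1; normal2 m₁ m₂] = 1 := by
    have := variance_map (X := fun x : ℝ => x) (μ := normal2 m₁ m₂) (Y := Prod.fst)
      (by fun_prop) (by fun_prop)
    rw [normal2, Measure.map_fst_prod, measure_univ, one_smul, variance_fun_id_gaussianReal] at this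
    exact this.symm.trans (by simp)
  have hv2 : Var[fun z : ℝ × ℝ => z.2; normal2 m₁ m₂] = 1 := by
    have := variance_map (X := fun x : ℝ => x) (μ := normal2 m₁ m₂) (Y := Prod.snd)
      (by fun_prop) (by fun_prop)
    rw [normal2, Measure.map_snd_prod, measure_univ, one_smul, variance_fun_id_gaussianReal] at this
    exact this.symm.trans (by simp)
  have e1 : (fun z : ℝ × ℝ => a * z.1 + b * z.2) = (fun z => a * z.1) + fun z => b * z.2 := rfl
  have e2 : (fun z : ℝ × ℝ => a' * z.1 + b' * z.2) = (fun z => a' * z.1) + fun z => b' * z.2 := rfl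
  rw [e1, e2, covariance_add_left (h1.const_mul _) (h2.const_mul _)
    ((h1.const_mul _).add (h2.const_mul _)),
    covariance_add_right (h1.const_mul _) (h1.const_mul _) (h2.const_mul _),
    covariance_add_right (h2.const_mul _) (h1.const_mul _) (h2.const_mul _)]
  simp only [covariance_const_mul_left, covariance_const_mul_right]
  rw [covariance_comm (fun z : ℝ × ℝ => z.2) (fun z => z.1), hc, covariance_self (by fun_prop),
    covariance_self (by fun_prop), hv1, hv2]
  ring

theorem integral_linear_normal2 (m₁ m₂ a b : ℝ) :
    ∫ z, (a * z.1 + b * z.2) ∂(normal2 m₁ m₂) = a * m₁ + b * m₂ := by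
  have hid : ∀ m, Integrable (fun x : ℝ => x) (gaussianReal m 1) := fun m =>
    IsGaussian.integrable_id
  have h1 : Integrable (fun z : ℝ × ℝ => z.1) (normal2 m₁ m₂) := (hid m₁).comp_fst _
  have h2 : Integrable (fun z : ℝ × ℝ => z.2) (normal2 m₁ m₂) := (hid m₂).comp_snd _
  rw [integral_add (h1.const_mul a) (h2.const_mul b), integral_const_mul, integral_const_mul,
    normal2, integral_fun_fst (fun x : ℝ => x), integral_fun_snd (fun x : ℝ => x)]
  simp

/-- `𝒰ᵀ z` as a map of the plane. -/
def rotate (U : Matrix (Fin 2) (Fin 2) ℝ) (z : ℝ × ℝ) : ℝ × ℝ :=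
  ((Uᵀ *ᵥ ![z.1, z.2]) 0, (Uᵀ *ᵥ ![z.1, z.2]) 1)

theorem rotate_eq (U : Matrix (Fin 2) (Fin 2) ℝ) (z : ℝ × ℝ) :
    rotate U z = (U 0 0 * z.1 + U 1 0 * z.2, U 0 1 * z.1 + U 1 1 * z.2) := by
  simp [rotate, Matrix.mulVec, dotProduct, Fin.sum_univ_two]

theorem measurable_rotate (U : Matrix (Fin 2) (Fin 2) ℝ) : Measurable (rotate U) := by
  have : rotate U = fun z => (U 0 0 * z.1 + U 1 0 * z.2, U 0 1 * z.1 + U 1 1 * z.2) :=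
    funext (rotate_eq U)
  rw [this]; fun_prop

/-- The columns of `U` are orthonormal, so the rotated coordinates are again uncorrelated with unit
variances; joint normality does the rest. -/
theorem map_rotate_normal2 {U : Matrix (Fin 2) (Fin 2) ℝ}
    (hU : U ∈ Matrix.orthogonalGroup (Fin 2) ℝ) (m₁ m₂ : ℝ) :
    (normal2 m₁ m₂).map (rotate U) = normal2 (rotate U (m₁, m₂)).1 (rotate U (m₁, m₂)).2 := by
  have hUU : Uᵀ * U = 1 := by
    have := (Matrix.mem_orthogonalGroup_iff' (Fin 2) ℝ).1 hU
    simpa [Matrix.star_eq_conjTranspose] using this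
  have hij : ∀ i j, U 0 i * U 0 j + U 1 i * U 1 j = (1 : Matrix (Fin 2) (Fin 2) ℝ) i j := by
    intro i j
    rw [← hUU]
    simp [Matrix.mul_apply, Fin.sum_univ_two]
  have h00 := hij 0 0
  have h11 := hij 1 1
  have h01 := hij 0 1
  simp at h00 h11 h01
  have hG : HasGaussianLaw (fun z : ℝ × ℝ =>
      (U 0 0 * z.1 + U 1 0 * z.2, U 0 1 * z.1 + U 1 1 * z.2)) (normal2 m₁ m₂) := by
    let F := ContinuousLinearMap.fst ℝ ℝ ℝ
    let S := ContinuousLinearMap.snd ℝ ℝ ℝ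
    exact IsGaussian.hasGaussianLaw_id.map_fun
      ((U 0 0 • F + U 1 0 • S).prod (U 0 1 • F + U 1 1 • S))
  have hvar : ∀ a b : ℝ, Var[fun z => a * z.1 + b * z.2; normal2 m₁ m₂] = a * a + b * b := by
    intro a b
    rw [← covariance_self (by fun_prop), cov_linear_normal2]
  have hmap := map_prodMk_eq_normal2 hG (by rw [cov_linear_normal2]; linarith)
    (integral_linear_normal2 _ _ _ _) (integral_linear_normal2 _ _ _ _)
    (by rw [hvar]; linarith) (by rw [hvar]; linarith)
  have hrot : rotate U = fun z => (U 0 0 * z.1 + U 1 0 * z.2, U 0 1 * z.1 + U 1 1 * z.2) :=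
    funext (rotate_eq U)
  rw [hrot]
  exact hmap

/-! ### The limiting law of the quadratic forms -/

/-- The covariance form of `(Q_{e(β₀)e(β₀)}, Q_{Xe(β₀)}, Q_XX)` with variance parameter `r`. -/
def VarPar.covForm (r : VarPar) (x y z x' y' z' : ℝ) : ℝ :=
  x * x' * r.Phi1 + (x * y' + y * x') * r.Phi12 + (x * z' + z * x') * r.Phi13
    + y * y' * r.Psi + (y * z' + z * y') * r.tau + z * z' * r.Ups

/-- `x Q_{e(β₀)e(β₀)} + y Q_{Xe(β₀)} + z Q_XX` as a function of `g = (Q_ee, Q_Xe, Q_XX - c)`. -/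
def linComb (Δ c x y z : ℝ) (g : EuclideanSpace ℝ (Fin 3)) : ℝ :=
  x * (g 0 + 2 * Δ * g 1 + Δ ^ 2 * (g 2 + c)) + y * (g 1 + Δ * (g 2 + c)) + z * (g 2 + c)

/-- The coefficient vector of `linComb`. -/
def linCoef (Δ x y z : ℝ) : EuclideanSpace ℝ (Fin 3) :=
  !₂[x, 2 * Δ * x + y, Δ ^ 2 * x + Δ * y + z]

theorem linComb_eq_inner (Δ c x y z : ℝ) (g : EuclideanSpace ℝ (Fin 3)) :
    linComb Δ c x y z g = inner ℝ (linCoef Δ x y z) g + (Δ ^ 2 * x + Δ * y + z) * c := by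
  simp [linComb, linCoef, PiLp.inner_apply, Fin.sum_univ_three]
  ring

theorem continuous_linComb (Δ c x y z : ℝ) : Continuous (linComb Δ c x y z) := by
  unfold linComb; fun_prop

section Gaussian

variable {S : Matrix (Fin 3) (Fin 3) ℝ} {Δ : ℝ}

/-- The polynomials in `gammaAt` are the entries of `S` after the linear change from `(Q_ee, Q_Xe,
Q_XX)` to the forms built with `e(β₀) = e + Δ X`. All covariances below are read off from this
identity. -/
theorem linCoef_form (hS : S.IsHermitian) (x y z x' y' z' : ℝ) :
    (linCoef Δ x y z : Fin 3 → ℝ) ⬝ᵥ S *ᵥ (linCoef Δ x' y' z' : Fin 3 → ℝ)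
      = (gammaAt S Δ).covForm x y z x' y' z' := by
  have h10 : S 1 0 = S 0 1 := by simpa using hS.apply 0 1
  have h20 : S 2 0 = S 0 2 := by simpa using hS.apply 0 2
  have h21 : S 2 1 = S 1 2 := by simpa using hS.apply 1 2
  simp [linCoef, dotProduct, Matrix.mulVec, Fin.sum_univ_three, VarPar.covForm, gammaAt,
    VarPar.Phi1, VarPar.Phi12, VarPar.Phi13, VarPar.Psi, VarPar.tau, VarPar.Ups, h10, h20, h21]
  ring

/-- The change of coefficients is triangular with unit diagonal, hence injective, so positive
definiteness of `S` is inherited. -/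
theorem covForm_pos (hS : S.PosDef) {x y z : ℝ} (h : x ≠ 0 ∨ y ≠ 0 ∨ z ≠ 0) :
    0 < (gammaAt S Δ).covForm x y z x y z := by
  rw [← linCoef_form hS.isHermitian]
  have hne : (linCoef Δ x y z : Fin 3 → ℝ) ≠ 0 := by
    intro h0
    have h1 : x = 0 := by simpa [linCoef] using congrFun h0 0
    have h2 : y = 0 := by simpa [linCoef, h1] using congrFun h0 1
    have h3 : z = 0 := by simpa [linCoef, h1, h2] using congrFun h0 2
    tauto
  simpa using hS.dotProduct_mulVec_pos hne

theorem integral_linComb (c x y z : ℝ) :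
    ∫ g, linComb Δ c x y z g ∂(multivariateGaussian 0 S) = (Δ ^ 2 * x + Δ * y + z) * c := by
  simp_rw [linComb_eq_inner]
  have hi : Integrable (fun g => inner ℝ (linCoef Δ x y z) g) (multivariateGaussian 0 S) :=
    IsGaussian.integrable_dual _ (innerSL ℝ (linCoef Δ x y z))
  rw [integral_add hi (integrable_const _)]
  have h0 : ∫ g, inner ℝ (linCoef Δ x y z) g ∂(multivariateGaussian 0 S) = 0 := by
    have := (innerSL ℝ (linCoef Δ x y z)).integral_comp_comm
      (IsGaussian.integrable_fun_id (μ := multivariateGaussian 0 S))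
    simpa using this
  rw [h0]
  simp

theorem cov_linComb (hS : S.PosSemidef) (c x y z x' y' z' : ℝ) :
    cov[linComb Δ c x y z, linComb Δ c x' y' z'; multivariateGaussian 0 S]
      = (gammaAt S Δ).covForm x y z x' y' z' := by
  have e : ∀ x y z, linComb Δ c x y z
      = fun g => inner ℝ (linCoef Δ x y z) g + (Δ ^ 2 * x + Δ * y + z) * c :=
    fun x y z => funext (linComb_eq_inner Δ c x y z)
  have hi : ∀ x y z, Integrable (fun g => inner ℝ (linCoef Δ x y z) g) (multivariateGaussian 0 S) :=
    fun x y z => IsGaussian.integrable_dual _ (innerSL ℝ (linCoef Δ x y z))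
  rw [e, e, covariance_add_const_left (hi _ _ _), covariance_add_const_right (hi _ _ _),
    ← covarianceBilin_apply_eq_cov IsGaussian.memLp_two_id, covarianceBilin_multivariateGaussian hS,
    linCoef_form hS.isHermitian]

theorem var_linComb (hS : S.PosSemidef) (c x y z : ℝ) :
    Var[linComb Δ c x y z; multivariateGaussian 0 S] = (gammaAt S Δ).covForm x y z x y z := by
  rw [← covariance_self (continuous_linComb _ _ _ _ _).aemeasurable, cov_linComb hS]

theorem hasGaussianLaw_linComb (c x y z x' y' z' x'' y'' z'' : ℝ) :
    HasGaussianLaw (fun g => (linComb Δ c x y z g, (linComb Δ c x' y' z' g,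
      linComb Δ c x'' y'' z'' g))) (multivariateGaussian 0 S) := by
  let L := (innerSL ℝ (linCoef Δ x y z)).prod
    ((innerSL ℝ (linCoef Δ x' y' z')).prod (innerSL ℝ (linCoef Δ x'' y'' z'')))
  let k : ℝ × ℝ × ℝ := ((Δ ^ 2 * x + Δ * y + z) * c, (Δ ^ 2 * x' + Δ * y' + z') * c,
    (Δ ^ 2 * x'' + Δ * y'' + z'') * c)
  have heq : (fun g => (linComb Δ c x y z g, (linComb Δ c x' y' z' g, linComb Δ c x'' y'' z'' g)))
      = (fun p => p + k) ∘ L := by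
    ext g <;> simp [linComb_eq_inner, L, k]
  constructor
  rw [heq, ← Measure.map_map (by fun_prop) (by fun_prop)]
  infer_instance

end Gaussian

/-! ### Variance parameters with positive definite covariance form -/

namespace VarPar

/-- The properties of `γ(β₀)` used for the limiting law. -/
structure Regular (r : VarPar) : Prop where
  covForm_pos : ∀ {x y z : ℝ}, x ≠ 0 ∨ y ≠ 0 ∨ z ≠ 0 → 0 < r.covForm x y z x y z
  rho_eq : r.rho = r.Phi12 / √(r.Phi1 * r.Psi)

/-- The formula holds also for a singular matrix, where both sides are `0` by convention.
Measurability can thus be proved on all of `Γ`, where `γ̂` takes its values. -/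
theorem projCoef_zero (r : VarPar) :
    r.projCoef 0 = (r.Psi * r.Phi13 - r.Phi12 * r.tau) / (r.Phi1 * r.Psi - r.Phi12 ^ 2) := by
  simp [projCoef, Matrix.inv_def, Matrix.adjugate_fin_two, Matrix.det_fin_two, Matrix.mulVec,
    dotProduct, Fin.sum_univ_two, Ring.inverse_eq_inv']
  ring

theorem projCoef_one (r : VarPar) :
    r.projCoef 1 = (r.Phi1 * r.tau - r.Phi12 * r.Phi13) / (r.Phi1 * r.Psi - r.Phi12 ^ 2) := by
  simp [projCoef, Matrix.inv_def, Matrix.adjugate_fin_two, Matrix.det_fin_two, Matrix.mulVec,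
    dotProduct, Fin.sum_univ_two, Ring.inverse_eq_inv']
  ring

namespace Regular

variable {r : VarPar}

theorem Phi1_pos (hr : r.Regular) : 0 < r.Phi1 := by
  have := hr.covForm_pos (x := 1) (y := 0) (z := 0) (by simp)
  simpa [covForm] using this

theorem Psi_pos (hr : r.Regular) : 0 < r.Psi := by
  have := hr.covForm_pos (x := 0) (y := 1) (z := 0) (by simp)
  simpa [covForm] using this

theorem det_pos (hr : r.Regular) : 0 < r.Phi1 * r.Psi - r.Phi12 ^ 2 := by
  have h1 := hr.Phi1_pos
  -- At this vector the form equals `Φ₁` times the determinant.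
  have := hr.covForm_pos (x := r.Phi12) (y := -r.Phi1) (z := 0) (by right; left; simpa using h1.ne')
  simp only [covForm] at this
  have h2 : 0 < r.Phi1 * (r.Phi1 * r.Psi - r.Phi12 ^ 2) := by nlinarith
  exact pos_of_mul_pos_right h2 h1.le

theorem Phi12_eq (hr : r.Regular) : r.Phi12 = r.rho * (√r.Phi1 * √r.Psi) := by
  have h1 := Real.sqrt_pos.2 hr.Phi1_pos
  have h2 := Real.sqrt_pos.2 hr.Psi_pos
  rw [hr.rho_eq, Real.sqrt_mul hr.Phi1_pos.le]
  field_simp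

theorem one_sub_rho_sq_pos (hr : r.Regular) : 0 < 1 - r.rho ^ 2 := by
  have hd := hr.det_pos
  have h1 := hr.Phi1_pos
  have h2 := hr.Psi_pos
  have h : r.Phi12 ^ 2 = r.rho ^ 2 * (r.Phi1 * r.Psi) := by
    rw [hr.Phi12_eq, mul_pow, mul_pow, Real.sq_sqrt h1.le, Real.sq_sqrt h2.le]
  rw [h] at hd
  have h3 : 0 < (1 - r.rho ^ 2) * (r.Phi1 * r.Psi) := by nlinarith
  exact pos_of_mul_pos_left h3 (mul_pos h1 h2).le

/-- Together with `proj_second` these are the normal equations: the projection residual is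
uncorrelated with both regressors. -/
theorem proj_first (hr : r.Regular) : r.Phi1 * r.projCoef 0 + r.Phi12 * r.projCoef 1 = r.Phi13 := by
  rw [projCoef_zero, projCoef_one]
  have := hr.det_pos.ne'
  field_simp
  ring

theorem proj_second (hr : r.Regular) : r.Phi12 * r.projCoef 0 + r.Psi * r.projCoef 1 = r.tau := by
  rw [projCoef_zero, projCoef_one]
  have := hr.det_pos.ne'
  rw [mul_div_assoc', mul_div_assoc', ← add_div, div_eq_iff this]
  ring

end Regular

end VarPar

theorem regular_gammaAt {S : Matrix (Fin 3) (Fin 3) ℝ} (hS : S.PosDef) (Δ : ℝ) :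
    (gammaAt S Δ).Regular where
  covForm_pos := covForm_pos hS
  rho_eq := by simp [gammaAt, VarPar.rho, VarPar.Phi12, VarPar.Phi1, VarPar.Psi]

/-- `(D, (AR, LM^*))` for the variance parameter `r` and the concentration parameter `c`, as a
function of `g = (Q_ee, Q_Xe, Q_XX - c)`. -/
def jointStat (r : VarPar) (Δ c : ℝ) (g : EuclideanSpace ℝ (Fin 3)) : ℝ × ℝ × ℝ :=
  (linComb Δ c (-r.projCoef 0) (-r.projCoef 1) 1 g,
    linComb Δ c (√r.Phi1)⁻¹ 0 0 g,
    linComb Δ c (-(√(1 - r.rho ^ 2))⁻¹ * r.rho * (√r.Phi1)⁻¹)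
      ((√(1 - r.rho ^ 2))⁻¹ * (√r.Psi)⁻¹) 0 g)

theorem measurable_jointStat (r : VarPar) (Δ c : ℝ) : Measurable (jointStat r Δ c) :=
  (continuous_linComb _ _ _ _ _).measurable.prodMk
    ((continuous_linComb _ _ _ _ _).measurable.prodMk (continuous_linComb _ _ _ _ _).measurable)

/-- The three covariances vanish by the normal equations and by the definition of `ρ`. Of the law of
`D` only its normality and nonzero variance matter later, so its parameters stay existential. -/
theorem map_jointStat {S : Matrix (Fin 3) (Fin 3) ℝ} (hS : S.PosDef) (Δ c : ℝ) {r : VarPar}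
    (hr : r = gammaAt S Δ) :
    ∃ m : ℝ, ∃ v : NNReal, v ≠ 0 ∧ (multivariateGaussian 0 S).map (jointStat r Δ c)
      = (gaussianReal m v).prod (normal2 (r.m1 Δ c) (r.m2 Δ c)) := by
  have hreg : r.Regular := hr ▸ regular_gammaAt hS Δ
  have ha := Real.sqrt_pos.2 hreg.Phi1_pos
  have hb := Real.sqrt_pos.2 hreg.Psi_pos
  have hs := Real.sqrt_pos.2 hreg.one_sub_rho_sq_pos
  have ha2 := Real.sq_sqrt hreg.Phi1_pos.le
  have hb2 := Real.sq_sqrt hreg.Psi_pos.le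
  have hs2 := Real.sq_sqrt hreg.one_sub_rho_sq_pos.le
  have h12 := hreg.Phi12_eq
  have hp1 := hreg.proj_first
  have hp2 := hreg.proj_second
  have hvar := hreg.covForm_pos (x := -r.projCoef 0) (y := -r.projCoef 1) (z := 1) (by simp)
  refine ⟨_, _, ?_, map_prodMk_eq_prod_normal2 (hasGaussianLaw_linComb _ _ _ _ _ _ _ _ _ _)
    ?_ ?_ ?_ ?_ ?_ ?_ ?_⟩
  · rw [var_linComb hS.posSemidef, ← hr]
    simpa using hvar
  · rw [cov_linComb hS.posSemidef, ← hr, VarPar.covForm, h12, ← ha2]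
    field_simp
    simp
  · rw [cov_linComb hS.posSemidef, ← hr, VarPar.covForm]
    linear_combination (-(√r.Phi1)⁻¹) * hp1
  · rw [cov_linComb hS.posSemidef, ← hr, VarPar.covForm]
    linear_combination ((√(1 - r.rho ^ 2))⁻¹ * r.rho * (√r.Phi1)⁻¹) * hp1
      - ((√(1 - r.rho ^ 2))⁻¹ * (√r.Psi)⁻¹) * hp2
  · rw [integral_linComb, VarPar.m1]; ring
  · rw [integral_linComb, VarPar.m2]; ring
  · rw [var_linComb hS.posSemidef, ← hr, VarPar.covForm]
    generalize √r.Phi1 = a at *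
    rw [← ha2]
    field_simp
    ring
  · rw [var_linComb hS.posSemidef, ← hr, VarPar.covForm, h12]
    generalize √r.Phi1 = a at *
    generalize √r.Psi = b at *
    generalize √(1 - r.rho ^ 2) = s at *
    rw [← ha2, ← hb2]
    field_simp
    rw [hs2]
    ring

/-! ### Almost everywhere statements -/

theorem ae_ae_slice {G : ℝ × ℝ × ℝ → Prop} (h : ∀ᵐ p, G p) :
    ∀ᵐ d : ℝ, ∀ᵐ z : ℝ × ℝ, G (z.1, z.2, d) := by
  have h1 : ∀ᵐ p : (ℝ × ℝ) × ℝ, G (p.1.1, p.1.2, p.2) :=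
    (volume_preserving_prodAssoc (α₁ := ℝ) (β₁ := ℝ) (γ₁ := ℝ)).quasiMeasurePreserving.ae h
  have h2 : ∀ᵐ p ∂((volume : Measure ℝ).prod (volume : Measure (ℝ × ℝ))),
      G (p.2.1, p.2.2, p.1) :=
    (Measure.measurePreserving_swap (μ := (volume : Measure ℝ))
      (ν := (volume : Measure (ℝ × ℝ)))).quasiMeasurePreserving.ae h1
  exact Measure.ae_ae_of_ae_prod h2

/-- The preimage of a null set under squaring lies in the images of its positive part under `√` and
`-√`, together with `0`. Differentiable maps preserve null sets; the origin is split off because `√`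
is not differentiable there. -/
theorem quasiMeasurePreserving_sq :
    Measure.QuasiMeasurePreserving (fun x : ℝ => x ^ 2) volume volume := by
  refine ⟨by fun_prop, Measure.AbsolutelyContinuous.mk fun s hs h0 => ?_⟩
  rw [Measure.map_apply (by fun_prop) hs]
  have hd : DifferentiableOn ℝ Real.sqrt (s ∩ Set.Ioi 0) := fun x hx =>
    (differentiableAt_id.sqrt (ne_of_gt hx.2)).differentiableWithinAt
  have hd' : DifferentiableOn ℝ (fun x => -√x) (s ∩ Set.Ioi 0) := hd.neg
  have hn : volume (s ∩ Set.Ioi 0) = 0 := measure_mono_null Set.inter_subset_left h0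
  have h1 := addHaar_image_eq_zero_of_differentiableOn_of_addHaar_eq_zero volume hd hn
  have h2 := addHaar_image_eq_zero_of_differentiableOn_of_addHaar_eq_zero volume hd' hn
  refine measure_mono_null ?_ (measure_union_null (measure_union_null h1 h2)
    (measure_singleton (0 : ℝ)))
  intro x hx
  rcases lt_trichotomy x 0 with h | h | h
  · refine Or.inl (Or.inr ⟨x ^ 2, ⟨hx, sq_pos_of_neg h⟩, ?_⟩)
    simp only [Real.sqrt_sq_eq_abs, abs_of_neg h, neg_neg]
  · exact Or.inr h
  · refine Or.inl (Or.inl ⟨x ^ 2, ⟨hx, pow_pos h 2⟩, ?_⟩)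
    exact Real.sqrt_sq h.le

/-- A competitor is evaluated at squared rotated statistics, so its exceptional null set must be
pulled back through both squaring and rotation. -/
theorem ae_sq_rotate {G : ℝ × ℝ → Prop} (h : ∀ᵐ p, G p) {U : Matrix (Fin 2) (Fin 2) ℝ}
    (hU : U ∈ Matrix.orthogonalGroup (Fin 2) ℝ) (m₁ m₂ : ℝ) :
    ∀ᵐ z ∂(normal2 m₁ m₂), G ((rotate U z).1 ^ 2, (rotate U z).2 ^ 2) := by
  have hac : ((volume : Measure ℝ).prod volume).map
      (Prod.map (fun x : ℝ => x ^ 2) fun x : ℝ => x ^ 2) ≪ (volume : Measure ℝ).prod volume := by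
    rw [← Measure.map_prod_map _ _ (by fun_prop) (by fun_prop)]
    exact quasiMeasurePreserving_sq.absolutelyContinuous.prod
      quasiMeasurePreserving_sq.absolutelyContinuous
  have h1 : ∀ᵐ p : ℝ × ℝ, G (p.1 ^ 2, p.2 ^ 2) :=
    ae_of_ae_map (by fun_prop) (hac.ae_le h)
  have h2 := (normal2_absolutelyContinuous (rotate U (m₁, m₂)).1 (rotate U (m₁, m₂)).2).ae_le h1
  rw [← map_rotate_normal2 hU] at h2
  exact ae_of_ae_map (measurable_rotate U).aemeasurable h2

/-! ### Almost sure continuity at the limiting variance parameter. -/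

section Regular

variable {Γ : Set VarPar} {r0 : Γ} {A : ℝ → Γ → ℝ × ℝ} {U : ℝ → Γ → Matrix (Fin 2) (Fin 2) ℝ}
  {φ : ℝ × ℝ × ℝ → Γ → ℝ}

theorem continuousAt_curry {Z : Type*} [TopologicalSpace Z] {X Y : Type*} [TopologicalSpace X]
    [TopologicalSpace Y] {f : X → Y → Z} {x : X} {y : Y}
    (h : ContinuousAt (Function.uncurry f) (x, y)) : ContinuousAt (fun x => f x y) x :=
  ContinuousAt.comp (g := Function.uncurry f) (f := fun x => (x, y)) h (by fun_prop)

theorem volume_compl_regularPoints (hA : ∀ᵐ d : ℝ, ContinuousAt (Function.uncurry A) (d, r0))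
    (hU : ∀ᵐ d : ℝ, ContinuousAt (Function.uncurry U) (d, r0))
    (hφ : ∀ᵐ p : ℝ × ℝ × ℝ, ContinuousAt (Function.uncurry φ) (p, r0)) :
    volume (regularPoints A U φ r0)ᶜ = 0 := by
  have h : ∀ᵐ d : ℝ, d ∈ regularPoints A U φ r0 := by
    filter_upwards [hA, hU, ae_ae_slice hφ] with d h1 h2 h3
    exact ⟨continuousAt_curry h1, continuousAt_curry h2, h3.mono fun z hz => continuousAt_curry hz⟩
  exact ae_iff.1 h

theorem measurable_rotate_uncurry (hU : ∀ i j, Measurable fun x : ℝ × Γ => U x.1 x.2 i j) :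
    Measurable fun p : (ℝ × Γ) × ℝ × ℝ => rotate (U p.1.1 p.1.2) p.2 := by
  have h : ∀ i j, Measurable fun p : (ℝ × Γ) × ℝ × ℝ => U p.1.1 p.1.2 i j := fun i j =>
    (hU i j).comp measurable_fst
  have e : (fun p : (ℝ × Γ) × ℝ × ℝ => rotate (U p.1.1 p.1.2) p.2) = fun p =>
      (U p.1.1 p.1.2 0 0 * p.2.1 + U p.1.1 p.1.2 1 0 * p.2.2,
        U p.1.1 p.1.2 0 1 * p.2.1 + U p.1.1 p.1.2 1 1 * p.2.2) := funext fun p => rotate_eq _ _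
  rw [e]
  exact (((h 0 0).mul (by fun_prop)).add ((h 1 0).mul (by fun_prop))).prodMk
    (((h 0 1).mul (by fun_prop)).add ((h 1 1).mul (by fun_prop)))

theorem ae_continuousAt_rival (hUm : ∀ i j, Measurable fun x : ℝ × Γ => U x.1 x.2 i j)
    (hUo : ∀ d, U d r0 ∈ Matrix.orthogonalGroup (Fin 2) ℝ)
    (hφ : ∀ᵐ p : ℝ × ℝ × ℝ, ContinuousAt (Function.uncurry φ) (p, r0))
    {m : ℝ} {v : NNReal} (hv : v ≠ 0) (m₁ m₂ : ℝ) :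
    ∀ᵐ q ∂((gaussianReal m v).prod (normal2 m₁ m₂)), ContinuousAt (Function.uncurry φ)
      (((rotate (U q.1 r0) q.2).1 ^ 2, (rotate (U q.1 r0) q.2).2 ^ 2, q.1), r0) := by
  -- The continuity set of any function into a metric space is a Gδ set; this supplies the
  -- measurability that Fubini needs.
  have hS : MeasurableSet {p : (ℝ × ℝ × ℝ) × Γ | ContinuousAt (Function.uncurry φ) p} :=
    (IsGδ.setOfPred_continuousAt _).measurableSet
  have hrot : Measurable fun q : ℝ × ℝ × ℝ => rotate (U q.1 r0) q.2 :=
    (measurable_rotate_uncurry hUm).comp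
      (((measurable_fst).prodMk measurable_const).prodMk measurable_snd)
  have hκ : Measurable fun q : ℝ × ℝ × ℝ => (((rotate (U q.1 r0) q.2).1 ^ 2,
      (rotate (U q.1 r0) q.2).2 ^ 2, q.1), r0) :=
    ((hrot.fst.pow_const 2).prodMk ((hrot.snd.pow_const 2).prodMk measurable_fst)).prodMk
      measurable_const
  refine (Measure.ae_prod_iff_ae_ae (p := fun q : ℝ × ℝ × ℝ => ContinuousAt (Function.uncurry φ)
    (((rotate (U q.1 r0) q.2).1 ^ 2, (rotate (U q.1 r0) q.2).2 ^ 2, q.1), r0)) (hκ hS)).2 ?_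
  filter_upwards [(gaussianReal_absolutelyContinuous m hv).ae_le (ae_ae_slice hφ)] with d hd
  exact ae_sq_rotate (G := fun p => ContinuousAt (Function.uncurry φ) ((p.1, p.2, d), r0)) hd
    (hUo d) m₁ m₂

theorem ae_combStat_ne_critVal {α abar : ℝ} (hα0 : 0 < α) (hα1 : α < 1) (habar : abar < 1)
    (hAm : Measurable (Function.uncurry A)) (hA : ∀ d, A d r0 ∈ weights0 abar)
    (m : ℝ) (v : NNReal) (m₁ m₂ : ℝ) :
    ∀ᵐ q ∂((gaussianReal m v).prod (normal2 m₁ m₂)),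
      combStat (A q.1 r0) (r0 : VarPar).rho q.2.1 q.2.2
        ≠ critVal α (A q.1 r0) (r0 : VarPar).rho := by
  have hA' : Measurable fun q : ℝ × ℝ × ℝ => A q.1 r0 :=
    hAm.comp (measurable_fst.prodMk measurable_const)
  have h1 : Measurable fun q : ℝ × ℝ × ℝ =>
      combStat (A q.1 r0) (r0 : VarPar).rho q.2.1 q.2.2 :=
    continuous_combStat.measurable.comp ((hA'.prodMk measurable_const).prodMk measurable_snd)
  have h2 : Measurable fun q : ℝ × ℝ × ℝ => critVal α (A q.1 r0) (r0 : VarPar).rho :=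
    measurable_critVal_comp hα0 hα1 hA' measurable_const
  have hms : MeasurableSet {q : ℝ × ℝ × ℝ | combStat (A q.1 r0) (r0 : VarPar).rho q.2.1 q.2.2
      ≠ critVal α (A q.1 r0) (r0 : VarPar).rho} := (measurableSet_eq_fun h1 h2).compl
  refine (Measure.ae_prod_iff_ae_ae hms).2 ?_
  exact Eventually.of_forall fun d =>
    ae_combStat_ne habar (hA d) (critVal α (A d r0) (r0 : VarPar).rho) m₁ m₂

end Regular

/-! ### Local averages -/

theorem tendsto_localAverage (κ : Measure ℝ) [IsProbabilityMeasure κ] [κ.IsOpenPosMeasure]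
    {H : ℝ → ℝ} (hH : Measurable H) (h01 : ∀ x, H x ∈ Set.Icc (0 : ℝ) 1) {d : ℝ}
    (hd : ContinuousAt H d) :
    Tendsto (fun ε => (∫ x in {x | |x - d| ≤ ε}, H x ∂κ) / κ.real {x | |x - d| ≤ ε})
      (𝓝[>] 0) (𝓝 (H d)) := by
  rw [Metric.tendsto_nhds]
  intro η hη
  obtain ⟨δ, hδ, hclose⟩ := Metric.continuousAt_iff.1 hd (η / 2) (half_pos hη)
  filter_upwards [Ioo_mem_nhdsGT hδ] with ε hε
  have hms : MeasurableSet {x : ℝ | |x - d| ≤ ε} := measurableSet_le (by fun_prop) measurable_const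
  have hpos : 0 < κ.real {x : ℝ | |x - d| ≤ ε} := by
    refine ENNReal.toReal_pos ?_ (measure_ne_top _ _)
    refine (Measure.measure_pos_of_mem_nhds κ (x := d) ?_).ne'
    filter_upwards [Metric.closedBall_mem_nhds d hε.1] with x hx
    simpa [Real.dist_eq] using hx
  have hint : IntegrableOn H {x | |x - d| ≤ ε} κ := (integrable_of_mem_Icc hH h01).integrableOn
  have hsub : (∫ x in {x | |x - d| ≤ ε}, H x ∂κ) - κ.real {x | |x - d| ≤ ε} * H d
      = ∫ x in {x | |x - d| ≤ ε}, (H x - H d) ∂κ := by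
    rw [integral_sub hint (integrable_const _)]
    simp
  have hbound : ‖∫ x in {x | |x - d| ≤ ε}, (H x - H d) ∂κ‖
      ≤ η / 2 * κ.real {x | |x - d| ≤ ε} := by
    refine norm_setIntegral_le_of_norm_le_const (measure_lt_top _ _) fun x hx => ?_
    have hx' : |x - d| ≤ ε := hx
    exact (hclose (by rw [Real.dist_eq]; exact hx'.trans_lt hε.2)).le
  rw [Real.dist_eq, div_sub' hpos.ne', hsub, abs_div, abs_of_pos hpos]
  rw [Real.norm_eq_abs] at hbound
  calc _ ≤ η / 2 := (div_le_iff₀ hpos).2 hbound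
    _ < η := half_lt_self hη

/-! ### The statistics as functions of the quadratic forms -/

section JointStat

variable {Γ : Set VarPar} (Δ : ℝ)

/-- The concentration parameter is an argument next to the variance parameter because it too varies
with `n`. The pair has a constant limit and plays the role of `η` in the mapping theorem. -/
theorem measurable_jointStat_uncurry :
    Measurable fun p : EuclideanSpace ℝ (Fin 3) × Γ × ℝ => jointStat (p.2.1 : VarPar) Δ p.2.2 p.1 := by
  have hr : Measurable fun p : EuclideanSpace ℝ (Fin 3) × Γ × ℝ => (p.2.1 : VarPar) :=
    measurable_subtype_coe.comp measurable_snd.fst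
  have hri : ∀ i, Measurable fun p : EuclideanSpace ℝ (Fin 3) × Γ × ℝ => (p.2.1 : VarPar) i :=
    fun i => (EuclideanSpace.proj (𝕜 := ℝ) i).continuous.measurable.comp hr
  have h0 := hri 0
  have h1 := hri 1
  have h2 := hri 2
  have h3 := hri 3
  have h4 := hri 4
  have h6 := hri 6
  simp only [jointStat, linComb, VarPar.projCoef_zero, VarPar.projCoef_one, VarPar.Phi1,
    VarPar.Phi12, VarPar.Phi13, VarPar.Psi, VarPar.tau, VarPar.rho]
  fun_prop

theorem continuousAt_jointStat {r0 : Γ} (hr0 : (r0 : VarPar).Regular)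
    (g : EuclideanSpace ℝ (Fin 3)) (c : ℝ) :
    ContinuousAt (fun p : EuclideanSpace ℝ (Fin 3) × Γ × ℝ =>
      jointStat (p.2.1 : VarPar) Δ p.2.2 p.1) (g, r0, c) := by
  have hdet := hr0.det_pos.ne'
  have ha := (Real.sqrt_pos.2 hr0.Phi1_pos).ne'
  have hb := (Real.sqrt_pos.2 hr0.Psi_pos).ne'
  have hs := (Real.sqrt_pos.2 hr0.one_sub_rho_sq_pos).ne'
  simp only [VarPar.Phi1, VarPar.Phi12, VarPar.Psi, VarPar.rho] at hdet ha hb hs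
  have hr : ∀ i, Continuous fun p : EuclideanSpace ℝ (Fin 3) × Γ × ℝ => (p.2.1 : VarPar) i :=
    fun i => by fun_prop
  simp only [jointStat, linComb, VarPar.projCoef_zero, VarPar.projCoef_one, VarPar.Phi1,
    VarPar.Phi12, VarPar.Phi13, VarPar.Psi, VarPar.tau, VarPar.rho]
  fun_prop (disch := assumption)

end JointStat

namespace DGP

variable {Γ : Set VarPar} (E : DGP.{u} Γ)

/-- `(Q_ee, Q_Xe, Q_XX - 𝒞)`. -/
def forms (n : ℕ) (ω : E.Ω n) : EuclideanSpace ℝ (Fin 3) :=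
  !₂[E.Q n (E.e n ω) (E.e n ω), E.Q n (E.X n ω) (E.e n ω), E.Q n (E.X n ω) (E.X n ω) - E.conc n]

theorem P_symm (n : ℕ) (i j : Fin n) : E.P n i j = E.P n j i := by
  have h : (E.P n)ᵀ = E.P n := by
    simp [P, Matrix.transpose_mul, Matrix.transpose_nonsing_inv, Matrix.mul_assoc]
  exact congrFun (congrFun h j) i

theorem Q_comm (n : ℕ) (a b : Fin n → ℝ) : E.Q n a b = E.Q n b a := by
  have h : ∀ a b : Fin n → ℝ, (∑ i, ∑ j ∈ Finset.univ.erase i, a i * E.P n i j * b j)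
      = ∑ i, ∑ j, if j ≠ i then a i * E.P n i j * b j else 0 := by
    intro a b
    refine Finset.sum_congr rfl fun i _ => ?_
    rw [← Finset.sum_filter]
    congr 1
    ext j
    simp
  rw [Q, Q, h, h, Finset.sum_comm]
  congr 1
  refine Finset.sum_congr rfl fun i _ => Finset.sum_congr rfl fun j _ => ?_
  rw [E.P_symm n j i]
  by_cases hij : i = j
  · simp [hij]
  · rw [if_pos hij, if_pos (Ne.symm hij)]; ring

theorem Q_add_smul_right (n : ℕ) (a b c : Fin n → ℝ) (t : ℝ) :
    E.Q n a (fun i => b i + t * c i) = E.Q n a b + t * E.Q n a c := by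
  simp only [Q, mul_add, Finset.sum_add_distrib, add_div]
  congr 1
  rw [← mul_div_assoc, Finset.mul_sum]
  congr 1
  refine Finset.sum_congr rfl fun i _ => ?_
  rw [Finset.mul_sum]
  exact Finset.sum_congr rfl fun j _ => by ring

theorem eAt_eq (β0 : ℝ) (n : ℕ) (ω : E.Ω n) :
    E.eAt β0 n ω = fun i => E.e n ω i + (E.β - β0) * E.X n ω i := by
  ext i; simp only [eAt, Y]; ring

theorem Q_X_eAt (β0 : ℝ) (n : ℕ) (ω : E.Ω n) (c : ℝ) (hc : c = E.conc n) :
    E.Q n (E.X n ω) (E.eAt β0 n ω)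
      = E.forms n ω 1 + (E.β - β0) * (E.forms n ω 2 + c) := by
  rw [eAt_eq, Q_add_smul_right, hc]
  simp [forms]

theorem Q_eAt_eAt (β0 : ℝ) (n : ℕ) (ω : E.Ω n) (c : ℝ) (hc : c = E.conc n) :
    E.Q n (E.eAt β0 n ω) (E.eAt β0 n ω) = E.forms n ω 0 + 2 * (E.β - β0) * E.forms n ω 1
      + (E.β - β0) ^ 2 * (E.forms n ω 2 + c) := by
  have h : E.Q n (E.eAt β0 n ω) (E.e n ω)
      = E.Q n (E.e n ω) (E.e n ω) + (E.β - β0) * E.Q n (E.X n ω) (E.e n ω) := by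
    rw [Q_comm, eAt_eq, Q_add_smul_right, E.Q_comm n (E.e n ω) (E.X n ω)]
  have h' := E.Q_X_eAt β0 n ω c hc
  rw [Q_comm] at h'
  conv_lhs => arg 4; rw [eAt_eq]
  rw [Q_add_smul_right, h, h']
  simp [forms]
  ring

/-- The identity is exact in finite samples: the statistics are the limiting function with `γ̂` and
`𝒞` inserted, so no separate expansion of estimation errors is needed. -/
theorem jointStat_eq (β0 : ℝ) (n : ℕ) (ω : E.Ω n) :
    jointStat (E.gammaHat n ω : VarPar) (E.β - β0) (E.conc n) (E.forms n ω)
      = (E.Dhat β0 n ω, E.AR β0 n ω, E.LMstar β0 n ω) := by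
  have h1 := E.Q_X_eAt β0 n ω _ rfl
  have h2 := E.Q_eAt_eAt β0 n ω _ rfl
  have h3 : E.Q n (E.X n ω) (E.X n ω) = E.forms n ω 2 + E.conc n := by simp [forms]
  simp only [jointStat, linComb, Dhat, AR, LMstar, LM, h1, h2, h3, dotProduct, Fin.sum_univ_two,
    Matrix.cons_val_zero, Matrix.cons_val_one]
  refine Prod.ext ?_ (Prod.ext ?_ ?_) <;> simp only [] <;> ring

/-! ### Convergence of local averages to conditional power. -/

variable {E}

theorem tendsto_measure_dist {β0 : ℝ} {r0 : Γ} (hw : E.WeakIdentification)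
    (hr : E.ConsistentAt β0 r0) (δ : ℝ) (hδ : 0 < δ) :
    Tendsto (fun n => E.law n {ω | δ ≤ dist (E.gammaHat n ω, E.conc n) (r0, E.Ctilde)})
      atTop (𝓝 0) := by
  have h1 := (ENNReal.tendsto_toReal_iff (fun n => measure_ne_top (E.law n) _)
    ENNReal.zero_ne_top).1 (hr.2.2 δ hδ)
  refine tendsto_of_tendsto_of_tendsto_of_le_of_le' tendsto_const_nhds h1
    (Eventually.of_forall fun _ => zero_le) ?_
  filter_upwards [Metric.tendsto_nhds.1 hw δ hδ] with n hn
  refine measure_mono fun ω hω => ?_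
  have hω' : δ ≤ max (dist (E.gammaHat n ω) r0) (dist (E.conc n) E.Ctilde) := hω
  rcases le_max_iff.1 hω' with h | h
  · change δ ≤ ‖(E.gammaHat n ω : VarPar) - r0‖
    rwa [← dist_eq_norm]
  · exact absurd hn (not_lt.2 h)

/-- The conditional limiting power of a test that is a function of the quadratic forms and of the
estimated variance parameter. -/
theorem hasCondPower {β0 : ℝ} {r0 : Γ} (hw : E.WeakIdentification) (hn : E.AsympNormal)
    (hr : E.ConsistentAt β0 r0) {T : ∀ n, E.Ω n → ℝ}
    {f : EuclideanSpace ℝ (Fin 3) × Γ × ℝ → ℝ} (hf : Measurable f)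
    (hf01 : ∀ p, f p ∈ Set.Icc (0 : ℝ) 1)
    (hT : ∀ n ω, T n ω = f (E.forms n ω, E.gammaHat n ω, E.conc n))
    {h : ℝ × ℝ × ℝ → ℝ} (hh : Measurable h) (hh01 : ∀ q, h q ∈ Set.Icc (0 : ℝ) 1)
    (hfh : ∀ g, f (g, r0, E.Ctilde) = h (jointStat r0 (E.β - β0) E.Ctilde g))
    {G : ℝ × ℝ × ℝ → Prop}
    (hG : ∀ (m : ℝ) (v : NNReal) (m₁ m₂ : ℝ), v ≠ 0 →
      ∀ᵐ q ∂((gaussianReal m v).prod (normal2 m₁ m₂)), G q)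
    (hfG : ∀ g, G (jointStat r0 (E.β - β0) E.Ctilde g) → ContinuousAt f (g, r0, E.Ctilde))
    {d : ℝ} (hd : ∀ m₁ m₂ : ℝ, ∀ᵐ z ∂(normal2 m₁ m₂), ContinuousAt (fun x => h (x, z)) d) :
    E.HasCondPower β0 d T (∫ z, h (d, z) ∂(normal2 ((r0 : VarPar).m1 (E.β - β0) E.Ctilde)
      ((r0 : VarPar).m2 (E.β - β0) E.Ctilde))) := by
  set m₁ := (r0 : VarPar).m1 (E.β - β0) E.Ctilde
  set m₂ := (r0 : VarPar).m2 (E.β - β0) E.Ctilde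
  obtain ⟨hS, hconv⟩ := hn
  obtain ⟨m, v, hv, hmap⟩ := map_jointStat hS (E.β - β0) E.Ctilde hr.1
  have hreg : (r0 : VarPar).Regular := hr.1 ▸ regular_gammaAt hS (E.β - β0)
  set κ := gaussianReal m v
  have hκ : NullSingletonClass κ := nullSingletonClass_gaussianReal hv
  have hκpos : κ.IsOpenPosMeasure := (gaussianReal_absolutelyContinuous' m hv).isOpenPosMeasure
  set stat : EuclideanSpace ℝ (Fin 3) → ℝ × ℝ × ℝ := jointStat r0 (E.β - β0) E.Ctilde
  have hstat : Measurable stat := measurable_jointStat _ _ _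
  let D : EuclideanSpace ℝ (Fin 3) × Γ × ℝ → ℝ := fun p =>
    (jointStat (p.2.1 : VarPar) (E.β - β0) p.2.2 p.1).1
  have hD : Measurable D := (measurable_jointStat_uncurry (E.β - β0)).fst
  have hDhat : ∀ n ω, E.Dhat β0 n ω = D (E.forms n ω, E.gammaHat n ω, E.conc n) := fun n ω => by
    simp only [D, jointStat_eq]
  have hη : ∀ n, Measurable fun ω => (E.gammaHat n ω, E.conc n) := fun n =>
    (hr.2.1 n).prodMk measurable_const
  have hforms : ∀ n, AEMeasurable (E.forms n) (E.law n) := hconv.forall_aemeasurable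
  -- the limit of the numerators
  have key : ∀ (f' : EuclideanSpace ℝ (Fin 3) × Γ × ℝ → ℝ) (h' : ℝ × ℝ × ℝ → ℝ),
      Measurable f' → (∀ p, f' p ∈ Set.Icc (0 : ℝ) 1) → Measurable h' →
      (∀ q, h' q ∈ Set.Icc (0 : ℝ) 1) → (∀ g, f' (g, r0, E.Ctilde) = h' (stat g)) →
      (∀ g, G (stat g) → ContinuousAt f' (g, r0, E.Ctilde)) → ∀ ε : ℝ, 0 < ε →
      Tendsto (fun n => ∫ ω in {ω | |E.Dhat β0 n ω - d| ≤ ε},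
        f' (E.forms n ω, E.gammaHat n ω, E.conc n) ∂(E.law n)) atTop
        (𝓝 (∫ x in {x | |x - d| ≤ ε}, ∫ z, h' (x, z) ∂(normal2 m₁ m₂) ∂κ)) := by
    intro f' h' hf' hf01' hh' hh01' hfh' hfG' ε hε
    -- The window is included in the integrand, which then is discontinuous at most where `f'` is or
    -- where `|D - d| = ε`; the latter is null because the limiting `D` has no atoms.
    let W : Set (EuclideanSpace ℝ (Fin 3) × Γ × ℝ) := {p | |D p - d| ≤ ε}
    have hW : MeasurableSet W := measurableSet_le (by fun_prop) measurable_const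
    have hlim := tendsto_integral_of_continuousAt (P := E.law) (ξ := E.forms)
      (η := fun n ω => (E.gammaHat n ω, E.conc n)) (c := (r0, E.Ctilde)) (f := W.indicator f')
      hconv hη (tendsto_measure_dist hw hr) (hf'.indicator hW) (fun p => by
        unfold Set.indicator; split_ifs
        · exact hf01' p
        · simp) (by
        have hae : ∀ᵐ q ∂(κ.prod (normal2 m₁ m₂)), G q ∧ |q.1 - d| ≠ ε := by
          refine (hG m v m₁ m₂ hv).and ?_
          refine Measure.quasiMeasurePreserving_fst.ae (p := fun x => |x - d| ≠ ε) ?_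
          have hfin : {x : ℝ | |x - d| = ε}.Finite := by
            refine (Set.toFinite {d + ε, d - ε}).subset fun x hx => ?_
            have hx' : |x - d| = ε := hx
            rcases (abs_eq hε.le).1 hx' with h | h
            · left; linarith
            · right; simp only [Set.mem_singleton_iff]; linarith
          have := hfin.measure_zero κ
          simpa [ae_iff] using this
        rw [← hmap] at hae
        filter_upwards [ae_of_ae_map hstat.aemeasurable hae] with g hg
        have hDc : ContinuousAt D (g, r0, E.Ctilde) :=
          (continuousAt_jointStat (E.β - β0) hreg g E.Ctilde).fst
        have hDc' : ContinuousAt (fun p => |D p - d|) (g, r0, E.Ctilde) :=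
          (hDc.sub continuousAt_const).abs
        have hfc := hfG' g hg.1
        rcases lt_or_gt_of_ne hg.2 with hlt | hlt
        · refine hfc.congr ?_
          filter_upwards [hDc'.eventually_lt_const hlt] with p hp
          rw [Set.indicator_of_mem (by exact le_of_lt hp)]
        · refine (continuousAt_const (y := (0 : ℝ))).congr ?_
          filter_upwards [hDc'.eventually_const_lt hlt] with p hp
          rw [Set.indicator_of_notMem (by exact not_le.2 hp)])
    have hleft : ∀ n, ∫ ω in {ω | |E.Dhat β0 n ω - d| ≤ ε},
        f' (E.forms n ω, E.gammaHat n ω, E.conc n) ∂(E.law n)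
        = ∫ ω, W.indicator f' (E.forms n ω, E.gammaHat n ω, E.conc n) ∂(E.law n) := by
      intro n
      have hnull : NullMeasurableSet {ω | |E.Dhat β0 n ω - d| ≤ ε} (E.law n) := by
        simp_rw [hDhat]
        exact ((hforms n).prodMk (hη n).aemeasurable).nullMeasurableSet_preimage hW
      rw [← integral_indicator₀ hnull]
      refine integral_congr_ae (Eventually.of_forall fun ω => ?_)
      simp only [Set.indicator, W, hDhat, Set.mem_ofPred_eq]
    have hright : ∫ g, W.indicator f' (g, r0, E.Ctilde) ∂(multivariateGaussian 0 E.S)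
        = ∫ x in {x | |x - d| ≤ ε}, ∫ z, h' (x, z) ∂(normal2 m₁ m₂) ∂κ := by
      have hI : MeasurableSet {x : ℝ | |x - d| ≤ ε} :=
        measurableSet_le (by fun_prop) measurable_const
      have hI' : MeasurableSet {q : ℝ × ℝ × ℝ | |q.1 - d| ≤ ε} :=
        measurableSet_le (by fun_prop) measurable_const
      have hmeas : Measurable ({q : ℝ × ℝ × ℝ | |q.1 - d| ≤ ε}.indicator h') := hh'.indicator hI'
      have h1 : ∀ g, W.indicator f' (g, r0, E.Ctilde)
          = {q : ℝ × ℝ × ℝ | |q.1 - d| ≤ ε}.indicator h' (stat g) := by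
        intro g
        simp only [Set.indicator, W, D, Set.mem_ofPred_eq, hfh']
        rfl
      simp_rw [h1]
      rw [← integral_map hstat.aemeasurable hmeas.aestronglyMeasurable, hmap,
        integral_prod _ (integrable_of_mem_Icc hmeas fun q => by
          unfold Set.indicator; split_ifs
          · exact hh01' q
          · simp), ← integral_indicator hI]
      refine integral_congr_ae (Eventually.of_forall fun x => ?_)
      by_cases hx : |x - d| ≤ ε
      · simp [Set.indicator, hx, m₁, m₂]
      · simp [Set.indicator, hx]
    rw [← hright]
    simp_rw [hleft]
    exact hlim
  -- By independence of `D` and `(AR, LM*)`, `H x` is the power given `D = x`. Its continuity at `d`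
  -- justifies shrinking the window.
  let H : ℝ → ℝ := fun x => ∫ z, h (x, z) ∂(normal2 m₁ m₂)
  have hHm : Measurable H := (hh.stronglyMeasurable.integral_prod_right').measurable
  have hH01 : ∀ x, H x ∈ Set.Icc (0 : ℝ) 1 := fun x => by
    refine ⟨integral_nonneg fun z => (hh01 _).1, ?_⟩
    have := integral_mono (μ := normal2 m₁ m₂) (integrable_of_mem_Icc
      (hh.comp (measurable_const.prodMk measurable_id)) fun z => hh01 (x, z))
      (integrable_const (1 : ℝ)) fun z => (hh01 (x, z)).2
    simpa using this
  have hHc : ContinuousAt H d := by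
    refine continuousAt_of_dominated (bound := fun _ => 1) ?_ ?_ (integrable_const _) (hd m₁ m₂)
    · exact Eventually.of_forall fun x =>
        (hh.comp (measurable_const.prodMk measurable_id)).aestronglyMeasurable
    · refine Eventually.of_forall fun x => Eventually.of_forall fun z => ?_
      rw [Real.norm_of_nonneg (hh01 _).1]
      exact (hh01 _).2
  refine ⟨fun ε => (∫ x in {x | |x - d| ≤ ε}, H x ∂κ) / κ.real {x | |x - d| ≤ ε},
    fun ε hε => ?_, tendsto_localAverage κ hHm hH01 hHc⟩
  have hnum := key f h hf hf01 hh hh01 hfh hfG ε hε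
  -- The denominator is the numerator of the constant test, so the same limit theorem applies.
  have hden := key (fun _ => 1) (fun _ => 1) measurable_const (by simp) measurable_const (by simp)
    (fun _ => rfl) (fun _ _ => continuousAt_const) ε hε
  have hpos : 0 < κ.real {x : ℝ | |x - d| ≤ ε} := by
    refine ENNReal.toReal_pos ?_ (measure_ne_top _ _)
    refine (Measure.measure_pos_of_mem_nhds κ (x := d) ?_).ne'
    filter_upwards [Metric.closedBall_mem_nhds d hε] with x hx
    simpa [Real.dist_eq] using hx
  simp only [integral_const, probReal_univ, smul_eq_mul, mul_one, measureReal_restrict_apply_univ]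
    at hden
  unfold localPower
  simp_rw [hT]
  exact hnum.div hden hpos.ne'

end DGP

/-! ### The spectral form of the combined statistic -/

section Spectral

variable {a : ℝ × ℝ} {ρ : ℝ} {U : Matrix (Fin 2) (Fin 2) ℝ} {ν : Fin 2 → ℝ}

theorem orthogonal_entries (hU : U ∈ Matrix.orthogonalGroup (Fin 2) ℝ) :
    U 0 0 * U 0 0 + U 1 0 * U 1 0 = 1 ∧ U 0 1 * U 0 1 + U 1 1 * U 1 1 = 1 ∧
      U 0 0 * U 0 1 + U 1 0 * U 1 1 = 0 := by
  have hUU : Uᵀ * U = 1 := by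
    have := (Matrix.mem_orthogonalGroup_iff' (Fin 2) ℝ).1 hU
    simpa [Matrix.star_eq_conjTranspose] using this
  have hij : ∀ i j, U 0 i * U 0 j + U 1 i * U 1 j = (1 : Matrix (Fin 2) (Fin 2) ℝ) i j := by
    intro i j
    rw [← hUU]
    simp [Matrix.mul_apply, Fin.sum_univ_two]
  exact ⟨by simpa using hij 0 0, by simpa using hij 1 1, by simpa using hij 0 1⟩

theorem weightMatrix_entries (h : IsEigenDecomp (weightMatrix a ρ) U ν) :
    a.1 + a.2 * ρ ^ 2 = U 0 0 * ν 0 * U 0 0 + U 0 1 * ν 1 * U 0 1 ∧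
    a.2 * ρ * √(1 - ρ ^ 2) = U 0 0 * ν 0 * U 1 0 + U 0 1 * ν 1 * U 1 1 ∧
    1 - a.1 - a.2 * ρ ^ 2 = U 1 0 * ν 0 * U 1 0 + U 1 1 * ν 1 * U 1 1 := by
  have hM := h.2.2
  have hij : ∀ i j, weightMatrix a ρ i j = U i 0 * ν 0 * U j 0 + U i 1 * ν 1 * U j 1 := by
    intro i j
    conv_lhs => rw [hM]
    simp [Matrix.mul_apply, Fin.sum_univ_two, Matrix.diagonal]
  refine ⟨?_, ?_, ?_⟩
  · simpa [weightMatrix] using hij 0 0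
  · simpa [weightMatrix] using hij 0 1
  · simpa [weightMatrix] using hij 1 1

/-- `weightMatrix` is the matrix of the quadratic form `combStat`; positivity of `1 - ρ²` is needed
to simplify the squared square root. -/
theorem combStat_eq_quad (hρ : 0 < 1 - ρ ^ 2) (h : IsEigenDecomp (weightMatrix a ρ) U ν)
    (z : ℝ × ℝ) :
    combStat a ρ z.1 z.2 = ν 0 * (rotate U z).1 ^ 2 + ν 1 * (rotate U z).2 ^ 2 := by
  obtain ⟨h0, h1, h2⟩ := weightMatrix_entries h
  have hs := Real.sq_sqrt hρ.le
  rw [rotate_eq, combStat]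
  linear_combination z.1 ^ 2 * h0 + 2 * z.1 * z.2 * h1 + z.2 ^ 2 * h2 + a.2 * z.2 ^ 2 * hs

theorem eigenvalues_sum (h : IsEigenDecomp (weightMatrix a ρ) U ν) : ν 0 + ν 1 = 1 := by
  obtain ⟨h0, -, h2⟩ := weightMatrix_entries h
  obtain ⟨e0, e1, -⟩ := orthogonal_entries h.1
  linear_combination -h0 - h2 - ν 0 * e0 - ν 1 * e1

/-- The eigenvalues are the values of the nonnegative form at the orthonormal columns of `U`. -/
theorem eigenvalues_nonneg {abar : ℝ} (habar : abar < 1) (ha : a ∈ weights0 abar)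
    (hρ : 0 < 1 - ρ ^ 2) (h : IsEigenDecomp (weightMatrix a ρ) U ν) : 0 ≤ ν 0 ∧ 0 ≤ ν 1 := by
  obtain ⟨e0, e1, e01⟩ := orthogonal_entries h.1
  have h0 := combStat_nonneg (ρ := ρ) habar ha (U 0 0, U 1 0).1 (U 0 0, U 1 0).2
  have h1 := combStat_nonneg (ρ := ρ) habar ha (U 0 1, U 1 1).1 (U 0 1, U 1 1).2
  rw [combStat_eq_quad hρ h, rotate_eq] at h0 h1
  have e10 : U 0 1 * U 0 0 + U 1 1 * U 1 0 = 0 := by linarith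
  simp only [e0, e1, e01, e10] at h0 h1
  constructor <;> linarith

end Spectral

/-! ### Limiting power of the two tests -/

section Tests

variable {Γ : Set VarPar} {r0 : Γ} {A : ℝ → Γ → ℝ × ℝ} {U : ℝ → Γ → Matrix (Fin 2) (Fin 2) ℝ}
  {φ : ℝ × ℝ × ℝ → Γ → ℝ}

/-- The competitor as a function of `(D, (AR, LM^*))` and the variance parameter. -/
def rivalFun (U : ℝ → Γ → Matrix (Fin 2) (Fin 2) ℝ) (φ : ℝ × ℝ × ℝ → Γ → ℝ)
    (x : (ℝ × ℝ × ℝ) × Γ) : ℝ :=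
  φ ((rotate (U x.1.1 x.2) x.1.2).1 ^ 2, (rotate (U x.1.1 x.2) x.1.2).2 ^ 2, x.1.1) x.2

theorem measurable_rivalFun (hU : ∀ i j, Measurable fun x : ℝ × Γ => U x.1 x.2 i j)
    (hφ : Measurable (Function.uncurry φ)) : Measurable (rivalFun U φ) := by
  have hrot : Measurable fun x : (ℝ × ℝ × ℝ) × Γ => rotate (U x.1.1 x.2) x.1.2 :=
    (measurable_rotate_uncurry hU).comp
      ((measurable_fst.fst.prodMk measurable_snd).prodMk measurable_fst.snd)
  exact hφ.comp (((hrot.fst.pow_const 2).prodMk ((hrot.snd.pow_const 2).prodMk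
    measurable_fst.fst)).prodMk measurable_snd)

theorem continuousAt_rotate {X : Type*} [TopologicalSpace X] {V : X → Matrix (Fin 2) (Fin 2) ℝ}
    {z : X → ℝ × ℝ} {x : X} (hV : ContinuousAt V x) (hz : ContinuousAt z x) :
    ContinuousAt (fun x => rotate (V x) (z x)) x := by
  have h : ∀ i j, ContinuousAt (fun x => V x i j) x := fun i j =>
    (continuous_apply_apply i j).continuousAt.comp (f := V) hV
  simp only [rotate_eq]
  exact (((h 0 0).mul hz.fst).add ((h 1 0).mul hz.snd)).prodMk
    (((h 0 1).mul hz.fst).add ((h 1 1).mul hz.snd))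

theorem continuousAt_rivalFun {q : ℝ × ℝ × ℝ} (hU : ContinuousAt (Function.uncurry U) (q.1, r0))
    (hφ : ContinuousAt (Function.uncurry φ)
      (((rotate (U q.1 r0) q.2).1 ^ 2, (rotate (U q.1 r0) q.2).2 ^ 2, q.1), r0)) :
    ContinuousAt (rivalFun U φ) (q, r0) := by
  have hV : ContinuousAt (fun x : (ℝ × ℝ × ℝ) × Γ => U x.1.1 x.2) (q, r0) :=
    ContinuousAt.comp (g := Function.uncurry U) (f := fun x : (ℝ × ℝ × ℝ) × Γ => (x.1.1, x.2))
      hU (by fun_prop)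
  have hrot := continuousAt_rotate hV (z := fun x : (ℝ × ℝ × ℝ) × Γ => x.1.2) (by fun_prop)
  exact ContinuousAt.comp (g := Function.uncurry φ) (f := fun x : (ℝ × ℝ × ℝ) × Γ =>
    (((rotate (U x.1.1 x.2) x.1.2).1 ^ 2, (rotate (U x.1.1 x.2) x.1.2).2 ^ 2, x.1.1), x.2)) hφ
    (((hrot.fst.pow 2).prodMk ((hrot.snd.pow 2).prodMk (by fun_prop))).prodMk (by fun_prop))

/-- The limit in `n` needs joint continuity in `(d, r)`, which holds almost surely under the limit
law. Regularity of the particular `d` enters only when the window shrinks, with `r = r0` fixed. -/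
theorem DGP.hasCondPower_rival {E : DGP.{u} Γ} {α β0 : ℝ} (hw : E.WeakIdentification)
    (hn : E.AsympNormal) (hr : E.ConsistentAt β0 r0)
    (hUm : ∀ i j, Measurable fun x : ℝ × Γ => U x.1 x.2 i j)
    (hUo : ∀ d, U d r0 ∈ Matrix.orthogonalGroup (Fin 2) ℝ)
    (hUc : ∀ᵐ d : ℝ, ContinuousAt (Function.uncurry U) (d, r0))
    (hφ : IsLevelTest α φ) {d : ℝ} (hd : d ∈ regularPoints A U φ r0) :
    E.HasCondPower β0 d (E.rivalTest β0 U φ) (∫ z, rivalFun U φ ((d, z), r0)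
      ∂(normal2 ((r0 : VarPar).m1 (E.β - β0) E.Ctilde)
        ((r0 : VarPar).m2 (E.β - β0) E.Ctilde))) := by
  have hreg : (r0 : VarPar).Regular := hr.1 ▸ regular_gammaAt hn.1 (E.β - β0)
  have hm := measurable_rivalFun hUm hφ.measurable
  refine DGP.hasCondPower hw hn hr
    (f := fun p => rivalFun U φ (jointStat (p.2.1 : VarPar) (E.β - β0) p.2.2 p.1, p.2.1))
    (h := fun q => rivalFun U φ (q, r0))
    (G := fun q => ContinuousAt (Function.uncurry U) (q.1, r0) ∧
      ContinuousAt (Function.uncurry φ)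
        (((rotate (U q.1 r0) q.2).1 ^ 2, (rotate (U q.1 r0) q.2).2 ^ 2, q.1), r0))
    (hm.comp ((measurable_jointStat_uncurry _).prodMk measurable_snd.fst))
    (fun p => hφ.mem_Icc _ _) (fun n ω => ?_)
    (hm.comp (measurable_id.prodMk measurable_const)) (fun q => hφ.mem_Icc _ _) (fun g => rfl)
    (fun m v m₁ m₂ hv => ?_) (fun g hg => ?_) (fun m₁ m₂ => ?_)
  · simp only [E.jointStat_eq β0 n ω, rivalFun]
    rfl
  · refine Eventually.and ?_ (ae_continuousAt_rival hUm hUo (hφ.continuity r0) hv m₁ m₂)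
    exact Measure.quasiMeasurePreserving_fst.ae
      ((gaussianReal_absolutelyContinuous m hv).ae_le hUc)
  · exact ContinuousAt.comp (g := rivalFun U φ)
      (f := fun p : EuclideanSpace ℝ (Fin 3) × Γ × ℝ =>
        (jointStat (p.2.1 : VarPar) (E.β - β0) p.2.2 p.1, p.2.1))
      (continuousAt_rivalFun hg.1 hg.2)
      ((continuousAt_jointStat _ hreg g E.Ctilde).prodMk (by fun_prop))
  · filter_upwards [ae_sq_rotate hd.2.2 (hUo d) m₁ m₂] with z hz
    have hrot := continuousAt_rotate hd.2.1 (z := fun _ => z) continuousAt_const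
    exact ContinuousAt.comp (g := fun p => φ p r0) (f := fun x : ℝ =>
      ((rotate (U x r0) z).1 ^ 2, (rotate (U x r0) z).2 ^ 2, x)) hz
      ((hrot.fst.pow 2).prodMk ((hrot.snd.pow 2).prodMk continuousAt_id))

theorem continuousAt_ite_le {X : Type*} [TopologicalSpace X] {f g : X → ℝ} {x : X}
    [∀ y, Decidable (f y ≤ g y)] (hf : ContinuousAt f x) (hg : ContinuousAt g x) (hne : g x ≠ f x) :
    ContinuousAt (fun y => if f y ≤ g y then (1 : ℝ) else 0) x := by
  rcases lt_or_gt_of_ne hne with h | h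
  · refine (continuousAt_const (y := (0 : ℝ))).congr ?_
    filter_upwards [hg.eventually_lt hf h] with y hy
    rw [if_neg (not_le.2 hy)]
  · refine (continuousAt_const (y := (1 : ℝ))).congr ?_
    filter_upwards [hf.eventually_lt hg h] with y hy
    rw [if_pos hy.le]

theorem continuousAt_critVal_comp {α abar : ℝ} (hα0 : 0 < α) (hα1 : α < 1) (habar : abar < 1)
    {X : Type*} [TopologicalSpace X] {f : X → ℝ × ℝ} {g : X → ℝ} {x : X}
    (hx : f x ∈ weights0 abar) (hf : ContinuousAt f x) (hg : ContinuousAt g x) :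
    ContinuousAt (fun y => critVal α (f y) (g y)) x := by
  have h := ContinuousAt.comp (f := fun y => (f y, g y)) (x := x)
    (continuousAt_critVal (ρ := g x) hα0 hα1 habar hx) (hf.prodMk hg)
  simp only [Function.comp_def] at h
  exact h

open Classical in
theorem DGP.hasCondPower_clc {E : DGP.{u} Γ} {α abar β0 : ℝ} (hα0 : 0 < α) (hα1 : α < 1)
    (habar : abar < 1) (hw : E.WeakIdentification) (hn : E.AsympNormal) (hr : E.ConsistentAt β0 r0)
    (hAm : Measurable (Function.uncurry A)) (hA : ∀ d r, A d r ∈ weights0 abar)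
    (hAc : ∀ᵐ d : ℝ, ContinuousAt (Function.uncurry A) (d, r0))
    {d : ℝ} (hd : ContinuousAt (fun x => A x r0) d) :
    E.HasCondPower β0 d (E.clcTest α β0 A) (∫ z, (if critVal α (A d r0) (r0 : VarPar).rho
        ≤ combStat (A d r0) (r0 : VarPar).rho z.1 z.2 then (1 : ℝ) else 0)
      ∂(normal2 ((r0 : VarPar).m1 (E.β - β0) E.Ctilde)
        ((r0 : VarPar).m2 (E.β - β0) E.Ctilde))) := by
  have hreg : (r0 : VarPar).Regular := hr.1 ▸ regular_gammaAt hn.1 (E.β - β0)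
  have ite01 : ∀ (p : Prop) [Decidable p], (if p then (1 : ℝ) else 0) ∈ Set.Icc (0 : ℝ) 1 := by
    intro p _; split_ifs <;> simp
  let J : EuclideanSpace ℝ (Fin 3) × Γ × ℝ → ℝ × ℝ × ℝ := fun p =>
    jointStat (p.2.1 : VarPar) (E.β - β0) p.2.2 p.1
  -- `LM` is kept as a separate function because `LM = ρ AR + √(1 - ρ²) LM*` can fail at a value of
  -- `γ̂` with `ρ² ≥ 1`. It is used only at `r0`, in `hlm0`.
  let lm : EuclideanSpace ℝ (Fin 3) × Γ × ℝ → ℝ := fun p =>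
    linComb (E.β - β0) p.2.2 0 (√(p.2.1 : VarPar).Psi)⁻¹ 0 p.1
  let a : EuclideanSpace ℝ (Fin 3) × Γ × ℝ → ℝ × ℝ := fun p => A (J p).1 p.2.1
  let crit : EuclideanSpace ℝ (Fin 3) × Γ × ℝ → ℝ := fun p =>
    critVal α (a p) (p.2.1 : VarPar).rho
  let stat : EuclideanSpace ℝ (Fin 3) × Γ × ℝ → ℝ := fun p =>
    (a p).1 * (J p).2.1 ^ 2 + (a p).2 * lm p ^ 2 + (1 - (a p).1 - (a p).2) * (J p).2.2 ^ 2
  have hJm : Measurable J := measurable_jointStat_uncurry _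
  have hrc : ∀ i, Continuous fun p : EuclideanSpace ℝ (Fin 3) × Γ × ℝ => (p.2.1 : VarPar) i :=
    fun i => by fun_prop
  have hlm : Measurable lm := by
    have := (hrc 3).measurable
    simp only [lm, linComb, VarPar.Psi]
    fun_prop
  have ham : Measurable a := hAm.comp (hJm.fst.prodMk measurable_snd.fst)
  have hcritm : Measurable crit := measurable_critVal_comp hα0 hα1 ham (hrc 6).measurable
  have hstatm : Measurable stat := by simp only [stat]; fun_prop
  have hA0 : Measurable fun q : ℝ × ℝ × ℝ => A q.1 r0 :=
    hAm.comp (measurable_fst.prodMk measurable_const)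
  have hc0 : Measurable fun q : ℝ × ℝ × ℝ => critVal α (A q.1 r0) (r0 : VarPar).rho :=
    measurable_critVal_comp hα0 hα1 hA0 measurable_const
  have hs0 : Measurable fun q : ℝ × ℝ × ℝ =>
      combStat (A q.1 r0) (r0 : VarPar).rho q.2.1 q.2.2 :=
    continuous_combStat.measurable.comp ((hA0.prodMk measurable_const).prodMk measurable_snd)
  have hstat0 : ∀ g, stat (g, r0, E.Ctilde)
      = combStat (A (J (g, r0, E.Ctilde)).1 r0) (r0 : VarPar).rho
        (J (g, r0, E.Ctilde)).2.1 (J (g, r0, E.Ctilde)).2.2 := by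
    intro g
    have hs := (Real.sqrt_pos.2 hreg.one_sub_rho_sq_pos).ne'
    have hlm0 : lm (g, r0, E.Ctilde) = (r0 : VarPar).rho * (J (g, r0, E.Ctilde)).2.1
        + √(1 - (r0 : VarPar).rho ^ 2) * (J (g, r0, E.Ctilde)).2.2 := by
      simp only [lm, J, jointStat, linComb]
      field_simp
      ring
    simp only [stat, a, combStat, hlm0]
  refine DGP.hasCondPower hw hn hr
    (f := fun p => if crit p ≤ stat p then (1 : ℝ) else 0)
    (h := fun q => if critVal α (A q.1 r0) (r0 : VarPar).rho
        ≤ combStat (A q.1 r0) (r0 : VarPar).rho q.2.1 q.2.2 then (1 : ℝ) else 0)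
    (G := fun q => ContinuousAt (Function.uncurry A) (q.1, r0) ∧
      combStat (A q.1 r0) (r0 : VarPar).rho q.2.1 q.2.2
        ≠ critVal α (A q.1 r0) (r0 : VarPar).rho)
    (Measurable.ite (measurableSet_le hcritm hstatm) measurable_const measurable_const)
    (fun p => ite01 _) (fun n ω => ?_)
    (Measurable.ite (measurableSet_le hc0 hs0) measurable_const measurable_const)
    (fun q => ite01 _) (fun g => ?_)
    (fun m v m₁ m₂ hv => ?_) (fun g hg => ?_) (fun m₁ m₂ => ?_)
  · have hj : J (E.forms n ω, E.gammaHat n ω, E.conc n)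
        = (E.Dhat β0 n ω, E.AR β0 n ω, E.LMstar β0 n ω) := E.jointStat_eq β0 n ω
    have hl : lm (E.forms n ω, E.gammaHat n ω, E.conc n) = E.LM β0 n ω := by
      simp only [lm, linComb, LM, E.Q_X_eAt β0 n ω _ rfl]
      ring
    simp only [clcTest, crit, stat, a, hj, hl]
  · rw [hstat0]
  · refine Eventually.and ?_ (ae_combStat_ne_critVal hα0 hα1 habar hAm (fun d => hA d r0) m v m₁ m₂)
    exact Measure.quasiMeasurePreserving_fst.ae
      ((gaussianReal_absolutelyContinuous m hv).ae_le hAc)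
  · have hJc : ContinuousAt J (g, r0, E.Ctilde) := continuousAt_jointStat _ hreg g E.Ctilde
    have hb := (Real.sqrt_pos.2 hreg.Psi_pos).ne'
    have hlmc : ContinuousAt lm (g, r0, E.Ctilde) := by
      simp only [VarPar.Psi] at hb
      simp only [lm, linComb, VarPar.Psi]
      fun_prop (disch := assumption)
    have hac : ContinuousAt a (g, r0, E.Ctilde) :=
      ContinuousAt.comp (g := Function.uncurry A)
        (f := fun p : EuclideanSpace ℝ (Fin 3) × Γ × ℝ => ((J p).1, p.2.1)) hg.1
        (hJc.fst.prodMk (by fun_prop))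
    have hcc : ContinuousAt crit (g, r0, E.Ctilde) :=
      continuousAt_critVal_comp hα0 hα1 habar (hA _ _) hac (hrc 6).continuousAt
    have hsc : ContinuousAt stat (g, r0, E.Ctilde) :=
      ((hac.fst.mul (hJc.snd.fst.pow 2)).add (hac.snd.mul (hlmc.pow 2))).add
        (((continuousAt_const.sub hac.fst).sub hac.snd).mul (hJc.snd.snd.pow 2))
    refine continuousAt_ite_le hcc hsc ?_
    rw [hstat0]
    exact hg.2
  · filter_upwards [ae_combStat_ne (ρ := (r0 : VarPar).rho) habar (hA d r0)
      (critVal α (A d r0) (r0 : VarPar).rho) m₁ m₂] with z hz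
    refine continuousAt_ite_le
      (continuousAt_critVal_comp hα0 hα1 habar (hA _ _) hd continuousAt_const) ?_ hz
    unfold combStat
    exact ((hd.fst.mul continuousAt_const).add (hd.snd.mul continuousAt_const)).add
      (((continuousAt_const.sub hd.fst).sub hd.snd).mul continuousAt_const)

end Tests

/-! ### Power functions in the rotated coordinates -/

theorem integral_rotate {U : Matrix (Fin 2) (Fin 2) ℝ}
    (hU : U ∈ Matrix.orthogonalGroup (Fin 2) ℝ) {f : ℝ × ℝ → ℝ} (hf : Measurable f) (m₁ m₂ : ℝ) :
    ∫ z, f (rotate U z) ∂(normal2 m₁ m₂)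
      = ∫ z, f z ∂(normal2 ((![m₁, m₂] ᵥ* U) 0) ((![m₁, m₂] ᵥ* U) 1)) := by
  have h : ((![m₁, m₂] ᵥ* U) 0, (![m₁, m₂] ᵥ* U) 1) = rotate U (m₁, m₂) := by
    rw [rotate_eq]
    simp [Matrix.vecMul, dotProduct, Fin.sum_univ_two, mul_comm]
  obtain ⟨h0, h1⟩ := Prod.ext_iff.1 h
  dsimp only at h0 h1
  rw [h0, h1, ← map_rotate_normal2 hU, integral_map (measurable_rotate U).aemeasurable
    hf.aestronglyMeasurable]

theorem map_rotate_normal2_zero {U : Matrix (Fin 2) (Fin 2) ℝ}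
    (hU : U ∈ Matrix.orthogonalGroup (Fin 2) ℝ) :
    (normal2 0 0).map (rotate U) = normal2 0 0 := by
  rw [map_rotate_normal2 hU]
  simp [rotate_eq]

section Quad

variable {α abar : ℝ} {a : ℝ × ℝ} {ρ : ℝ} {U : Matrix (Fin 2) (Fin 2) ℝ} {ν : Fin 2 → ℝ}

open Classical in
theorem ite_critVal_le_combStat (hρ : 0 < 1 - ρ ^ 2) (h : IsEigenDecomp (weightMatrix a ρ) U ν)
    (z : ℝ × ℝ) : (if critVal α a ρ ≤ combStat a ρ z.1 z.2 then (1 : ℝ) else 0)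
      = quadTest (ν 0) (ν 1) (critVal α a ρ) (rotate U z) := by
  rw [combStat_eq_quad hρ h]
  split_ifs with hc
  · exact (quadTest_of_le hc).symm
  · exact (quadTest_of_lt (not_le.1 hc)).symm

theorem ae_quad_ne (habar : abar < 1) (ha : a ∈ weights0 abar) (hρ : 0 < 1 - ρ ^ 2)
    (h : IsEigenDecomp (weightMatrix a ρ) U ν) (t : ℝ) :
    ∀ᵐ z ∂(normal2 0 0), ν 0 * z.1 ^ 2 + ν 1 * z.2 ^ 2 ≠ t := by
  have hms : MeasurableSet {z : ℝ × ℝ | ν 0 * z.1 ^ 2 + ν 1 * z.2 ^ 2 ≠ t} :=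
    (measurableSet_eq_fun (by fun_prop) measurable_const).compl
  rw [← map_rotate_normal2_zero h.1, ae_map_iff (measurable_rotate U).aemeasurable hms]
  filter_upwards [ae_combStat_ne (ρ := ρ) habar ha t 0 0] with z hz
  rwa [← combStat_eq_quad hρ h]

/-- The standard normal law is rotation invariant, so the size bound for the combined statistic
passes to its diagonal form. -/
theorem le_integral_quadTest_critVal (hα0 : 0 < α) (hα1 : α < 1) (hρ : 0 < 1 - ρ ^ 2)
    (h : IsEigenDecomp (weightMatrix a ρ) U ν) :
    α ≤ ∫ z, quadTest (ν 0) (ν 1) (critVal α a ρ) z ∂(normal2 0 0) := by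
  refine (le_measureReal_critVal_le hα0 hα1 a ρ).trans_eq ?_
  rw [integral_quadTest]
  conv_rhs => rw [← map_rotate_normal2_zero h.1]
  rw [map_measureReal_apply (measurable_rotate U)
    (measurableSet_le measurable_const (by fun_prop))]
  simp only [Set.preimage_ofPred_eq, combStat_eq_quad hρ h]

end Quad

/-- A power inequality on a dense set of alternatives holds at every alternative. -/
theorem integral_normal2_le_of_dense {f g : ℝ × ℝ → ℝ} (hf : Measurable f) (hf1 : ∀ z, |f z| ≤ 1)
    (hg : Measurable g) (hg1 : ∀ z, |g z| ≤ 1) {T : Set (Fin 2 → ℝ)} (hT : Dense T)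
    (h : ∀ t ∈ T, ∫ z, f z ∂(normal2 (t 0) (t 1)) ≤ ∫ z, g z ∂(normal2 (t 0) (t 1))) (s t : ℝ) :
    ∫ z, f z ∂(normal2 s t) ≤ ∫ z, g z ∂(normal2 s t) := by
  have hcont : Continuous fun t : Fin 2 → ℝ => (t 0, t 1) := by fun_prop
  have hF := (continuous_integral_normal2 hf hf1).comp hcont
  have hG := (continuous_integral_normal2 hg hg1).comp hcont
  have hmem := (isClosed_le hF hG).closure_subset_iff.2 h (hT ![s, t])
  exact hmem

end JackknifeCLC

end

/-! ### Reduction to the limit experiment at a regular `d`, and the two optimality claims. -/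

theorem corollary1
    (𝒟 : JackknifeCLC.Design) (h𝒟 : 𝒟.Valid)
    (Γ : Set JackknifeCLC.VarPar) (r0 : Γ)
    (s : JackknifeCLC.Proxy)
    -- the minimax weights, and their continuity
    (A : ℝ → Γ → ℝ × ℝ) (hA_meas : Measurable (Function.uncurry A))
    (hA : ∀ (d : ℝ) (r : Γ), 𝒟.IsMinimax (A d r) (s.f d r) r)
    (hA_cont : ∀ᵐ d : ℝ, ContinuousAt (Function.uncurry A) (d, r0))
    -- the eigenvalue decomposition, and the continuity of the rotation
    (U : ℝ → Γ → Matrix (Fin 2) (Fin 2) ℝ) (hU_meas : ∀ i j, Measurable fun x : ℝ × Γ => U x.1 x.2 i j)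
    (ν : ℝ → Γ → Fin 2 → ℝ)
    (hU : ∀ (d : ℝ) (r : Γ), JackknifeCLC.IsEigenDecomp
      (JackknifeCLC.weightMatrix (A d r) (r : JackknifeCLC.VarPar).rho) (U d r) (ν d r))
    (hU_cont : ∀ᵐ d : ℝ, ContinuousAt (Function.uncurry U) (d, r0))
    -- a class of weakly identified models with common variance parameter `γ(β₀) = r0`
    (𝓔 : Set (JackknifeCLC.DGP.{u} Γ))
    (h𝓔 : ∀ E ∈ 𝓔, E.IsModel ∧ E.WeakIdentification ∧ E.AsympNormal ∧
      E.ConsistentAt 𝒟.β0 r0)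
    -- the competitor
    (φ : ℝ × ℝ × ℝ → Γ → ℝ) (hφ : JackknifeCLC.IsLevelTest 𝒟.α φ) :
    MeasureTheory.volume (JackknifeCLC.regularPoints A U φ r0)ᶜ = 0 ∧
    ∀ d ∈ JackknifeCLC.regularPoints A U φ r0,
      ∃ rival clc : JackknifeCLC.DGP.{u} Γ → ℝ,
        (∀ E ∈ 𝓔, E.HasCondPower 𝒟.β0 d (E.rivalTest 𝒟.β0 U φ) (rival E) ∧
          E.HasCondPower 𝒟.β0 d (E.clcTest 𝒟.α 𝒟.β0 A) (clc E)) ∧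
        -- (i) admissibility
        (Dense {t : Fin 2 → ℝ | ∃ E ∈ 𝓔, E.theta 𝒟.β0 r0 (U d r0) = t} →
          (∀ E ∈ 𝓔, clc E ≤ rival E) → ∀ E ∈ 𝓔, rival E = clc E) ∧
        -- (ii) optimality against small alternatives proportional to `(ν₁, ν₂)`
        (∃ bbar : ℝ, 0 < bbar ∧ ∀ b : ℝ, 0 < b → b < bbar → ∀ E ∈ 𝓔,
          (∀ i, E.theta 𝒟.β0 r0 (U d r0) i ^ 2 = b * ν d r0 i) → rival E ≤ clc E) := by

  open JackknifeCLC in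
  have hw : ∀ d r, A d r ∈ weights0 𝒟.abar := fun d r => (hA d r).1.1
  refine ⟨volume_compl_regularPoints hA_cont hU_cont (hφ.continuity r0), fun d hd => ?_⟩
  -- A member of the class is needed to know that `r0` comes from a positive definite matrix, hence
  -- `ρ² < 1`; for the empty class all claims are vacuous.
  rcases 𝓔.eq_empty_or_nonempty with rfl | ⟨E₀, hE₀⟩
  · exact ⟨fun _ => 0, fun _ => 0, by simp, by simp, 1, one_pos, by simp⟩
  have hρ : 0 < 1 - (r0 : VarPar).rho ^ 2 := by
    obtain ⟨-, -, hn, hr⟩ := h𝓔 E₀ hE₀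
    have hreg : (r0 : VarPar).Regular := hr.1 ▸ regular_gammaAt hn.1 (E₀.β - 𝒟.β0)
    exact hreg.one_sub_rho_sq_pos
  have hUo : ∀ d, U d r0 ∈ Matrix.orthogonalGroup (Fin 2) ℝ := fun d => (hU d r0).1
  let c := critVal 𝒟.α (A d r0) (r0 : VarPar).rho
  let q : ℝ × ℝ → ℝ := quadTest (ν d r0 0) (ν d r0 1) c
  let ψ : ℝ × ℝ → ℝ := fun z => φ (z.1 ^ 2, z.2 ^ 2, d) r0
  let θ : DGP.{u} Γ → Fin 2 → ℝ := fun E => E.theta 𝒟.β0 r0 (U d r0)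
  have hqm : Measurable q := measurable_quadTest
  have hq01 : ∀ z, q z ∈ Set.Icc (0 : ℝ) 1 := quadTest_mem_Icc
  have hψm : Measurable ψ := hφ.measurable.comp (by fun_prop :
    Measurable fun z : ℝ × ℝ => ((z.1 ^ 2, z.2 ^ 2, d), r0))
  have hψ01 : ∀ z, ψ z ∈ Set.Icc (0 : ℝ) 1 := fun z => hφ.mem_Icc _ _
  have habs : ∀ {x : ℝ}, x ∈ Set.Icc (0 : ℝ) 1 → |x| ≤ 1 := fun hx =>
    abs_le.2 ⟨by linarith [hx.1], hx.2⟩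
  obtain ⟨hv0, hv1⟩ := eigenvalues_nonneg h𝒟.abar_lt_one (hw d r0) hρ (hU d r0)
  have hc : 0 ≤ c := critVal_nonneg h𝒟.α_pos h𝒟.α_lt_one h𝒟.abar_lt_one (hw d r0)
  have hne := ae_quad_ne h𝒟.abar_lt_one (hw d r0) hρ (hU d r0) c
  have hlevel : ∫ z, ψ z ∂(normal2 0 0) ≤ ∫ z, q z ∂(normal2 0 0) :=
    (hφ.level d r0).trans (le_integral_quadTest_critVal h𝒟.α_pos h𝒟.α_lt_one hρ (hU d r0))
  -- Both limits are powers of fixed tests at the mean `θ E`. The tests depend on `d` but not on the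
  -- sequence, so a single `bbar` serves the whole class.
  refine ⟨fun E => ∫ z, ψ z ∂(normal2 (θ E 0) (θ E 1)),
    fun E => ∫ z, q z ∂(normal2 (θ E 0) (θ E 1)), fun E hE => ?_, fun hdense hle E _ => ?_, ?_⟩
  · obtain ⟨-, hwi, hn, hr⟩ := h𝓔 E hE
    constructor
    · have h := DGP.hasCondPower_rival hwi hn hr hU_meas hUo hU_cont hφ hd
      have he := integral_rotate (hUo d) hψm ((r0 : VarPar).m1 (E.β - 𝒟.β0) E.Ctilde)
        ((r0 : VarPar).m2 (E.β - 𝒟.β0) E.Ctilde)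
      exact (congrArg (E.HasCondPower 𝒟.β0 d _) he).mp h
    · have h := DGP.hasCondPower_clc h𝒟.α_pos h𝒟.α_lt_one h𝒟.abar_lt_one hwi hn hr hA_meas hw
        hA_cont hd.1
      simp only [ite_critVal_le_combStat hρ (hU d r0)] at h
      have he := integral_rotate (hUo d) hqm ((r0 : VarPar).m1 (E.β - 𝒟.β0) E.Ctilde)
        ((r0 : VarPar).m2 (E.β - 𝒟.β0) E.Ctilde)
      exact (congrArg (E.HasCondPower 𝒟.β0 d _) he).mp h
  · have hpow := integral_normal2_le_of_dense hqm (fun z => habs (hq01 z)) hψm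
      (fun z => habs (hψ01 z)) hdense (by rintro _ ⟨E, hE, rfl⟩; exact hle E hE)
    exact (integral_normal2_congr
      (ae_eq_quadTest hv0 hv1 hc hne hψm hψ01 hlevel hpow) _ _).symm
  · obtain ⟨bbar, hpos, hb⟩ := exists_pos_forall_integral_le_quadTest hv0 hv1
      (eigenvalues_sum (hU d r0)) hc hne hψm hψ01 (fun z => by simp [ψ]) (fun z => by simp [ψ])
      hlevel
    exact ⟨bbar, hpos, fun b hb0 hb1 E _ hθ => hb b hb0 hb1 _ _ (hθ 0) (hθ 1)⟩
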